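/- Let $G=(V,E)$ be a finite ribbon graph, that is, a surface with boundary presented as the union of a finite set $V$ of vertex discs and a finite set $E$ of edge discs, where vertices and edges meet in disjoint line segments, each segment lies on the boundary of exactly one vertex and exactly one edge, and each edge contains exactly two of them. ($G$ may be disconnected, non-orientable, and may have loops, multiple edges and isolated vertices; ribbon graphs are considered up to the usual equivalence.) Each $A\subseteq E$ determines the spanning ribbon subgraph $(V,A)$. Write $v(\cdot)$ and $k(\cdot)$ for the numbers of vertices and of connected components, and let $\gamma(\cdot)$ be the Euler genus: the genus of the closed surface obtained by capping off all boundary components with discs if that surface is connected and non-orientable, twice its genus if it is connected and orientable, extended additively over connected components; equivalently, the dimension of the first homology group of that closed surface with coefficients in $\mathbb{Z}/2\mathbb{Z}$. A spanning quasi-tree of $G$ is a spanning ribbon subgraph $Q$ with $k(Q)=k(G)$ each of whose connected components has exactly one boundary component. Let $D=D(G)=(E,\mathcal F)$, where $\mathcal F$, the collection of feasible sets, consists of the edge sets of the spanning quasi-trees of $G$. Let $D_{\min}$ and $D_{\max}$ be the set systems on $E$ formed by the feasible sets of minimum and of maximum cardinality; their ranks $r(D_{\min})$, $r(D_{\max})$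 are these cardinalities, and the width of $D$ is $w(D)=r(D_{\max})-r(D_{\min})$. $D$ is even if the cardinalities of all its feasible sets have the same parity. Then $D$ is a delta-matroid, i.e. $\mathcal F\neq\emptyset$ and for all $X,Y\in\mathcal F$ and $u\in X\bigtriangleup Y$ there is $v\in X\bigtriangleup Y$ (possibly $v=u$) with $X\bigtriangleup\{u,v\}\in\mathcal F$; moreover: 1. for every integer $m\ge 0$, the map that takes a spanning quasi-tree to its edge set is a bijection from the set of spanning quasi-trees of $G$ of Euler genus $m-v(G)+k(G)$ onto the set of feasible sets of $D$ of cardinality $m$; 2. $r(D_{\min})$ is equal to the number of edges of any maximal spanning forest of $G$, that is, $r(D_{\min})=v(G)-k(G)$; 3. $w(D)=\gamma(G)$; 4. $D$ is even if and only if $G$ is orientable. -/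

import Mathlib

/-! ## Set systems and delta-matroids -/

/-- A set system on a finite ground set `E`: a collection of feasible subsets of `E`. -/
structure SetSystem (E : Type*) where
  /-- the collection of feasible sets -/
  feasible : Set (Finset E)

namespace SetSystem

variable {E : Type*}

/-- A delta-matroid is a set system with at least one feasible set that satisfies the symmetric
exchange axiom (`v = u` is allowed). -/
def IsDeltaMatroid [DecidableEq E] (D : SetSystem E) : Prop :=
  D.feasible.Nonempty ∧
    ∀ X ∈ D.feasible, ∀ Y ∈ D.feasible, ∀ u ∈ symmDiff X Y,
      ∃ v ∈ symmDiff X Y, symmDiff X {u, v} ∈ D.feasible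

/-- `D_min`: the feasible sets are the feasible sets of `D` of minimum cardinality. -/
def lower (D : SetSystem E) : SetSystem E :=
  ⟨{F | F ∈ D.feasible ∧ ∀ F' ∈ D.feasible, F.card ≤ F'.card}⟩

/-- `D_max`: the feasible sets are the feasible sets of `D` of maximum cardinality. -/
def upper (D : SetSystem E) : SetSystem E :=
  ⟨{F | F ∈ D.feasible ∧ ∀ F' ∈ D.feasible, F'.card ≤ F.card}⟩

/-- The rank `r(M) = max {|E ∩ B| : B a basis} = max {|B| : B a basis}` of a matroid given by its
bases. -/
noncomputable def rank (M : SetSystem E) : ℕ :=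
  sSup (Finset.card '' M.feasible)

/-- The width `w(D) = r(D_max) - r(D_min)`. -/
noncomputable def width (D : SetSystem E) : ℤ :=
  (D.upper.rank : ℤ) - (D.lower.rank : ℤ)

/-- All feasible sets have the same parity. -/
def IsEven (D : SetSystem E) : Prop :=
  ∀ F ∈ D.feasible, ∀ F' ∈ D.feasible, (Even F.card ↔ Even F'.card)

end SetSystem

/-! ## Ribbon graphs -/

/-- A ribbon graph with set `V` of vertex discs and set `E` of edge discs, given by the gluing data
of the discs (a signed rotation system).

The edge disc `e` has two attaching line segments, called half-edges, `(e, false)` and `(e, true)`.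
`vert h` is the vertex disc on whose boundary the half-edge `h` lies. Fix an orientation of the
boundary circle of each vertex disc: `rot h` is the half-edge that follows `h` in the resulting
cyclic order, so the cycles of `rot` are the sets of half-edges at the vertices. A vertex without
half-edges is an isolated vertex. Finally, `twisted e` tells whether the band `e` is glued with a
half-twist relative to the chosen orientations of the vertex discs at its two ends. -/
structure RibbonGraph (V E : Type*) where
  /-- the vertex at which a half-edge is attached -/
  vert : E × Bool → V
  /-- the next half-edge in the cyclic order at its vertex -/
  rot : Equiv.Perm (E × Bool)
  /-- whether an edge is twisted -/
  twisted : E → Bool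
  vert_rot : ∀ h, vert (rot h) = vert h
  sameCycle_of_vert_eq : ∀ h h', vert h = vert h' → rot.SameCycle h h'

namespace RibbonGraph

variable {V E : Type*}

/-- A ribbon graph is orientable when regarded as a surface: the vertex discs can be oriented
(`o v = true`: reverse the given orientation of `v`) in such a way that no band is twisted
relative to the new orientations of the discs at its ends. -/
def Orientable (G : RibbonGraph V E) : Prop :=
  ∃ o : V → Bool, ∀ e, G.twisted e = xor (o (G.vert (e, false))) (o (G.vert (e, true)))

/-- The spanning ribbon subgraph `(V, A)` of `G`: all vertex discs, and the edge discs in `A`. -/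
@[ext]
structure SpanningSubgraph (G : RibbonGraph V E) where
  /-- the set `A` of edges that are kept -/
  edges : Finset E

/-- The ribbon graph `G` as a spanning ribbon subgraph of itself. -/
def whole [Fintype E] (G : RibbonGraph V E) : G.SpanningSubgraph := ⟨Finset.univ⟩

namespace SpanningSubgraph

variable {G : RibbonGraph V E}

/-- Adjacency through an edge of the spanning ribbon subgraph. -/
def Joined (Q : G.SpanningSubgraph) (u v : V) : Prop :=
  ∃ e ∈ Q.edges, G.vert (e, false) = u ∧ G.vert (e, true) = v

/-- The connected components of a spanning ribbon subgraph, as classes of vertices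
(`Quot` divides by the equivalence relation that `Joined` generates). -/
def Component (Q : G.SpanningSubgraph) : Type _ := Quot Q.Joined

/-- The number `k(Q)` of connected components. -/
noncomputable def k (Q : G.SpanningSubgraph) : ℕ := Nat.card Q.Component

/-- The end points of the half-edge `h` on the boundary of its vertex disc are the corners
`(h, false)`, met first, and `(h, true)`, met second, in the chosen direction around that disc.
`BoundaryStep Q` relates two corners joined by an arc of the boundary of the surface
`Q = (V, A)`, where the arc contains no other corner. Such an arc is
* a piece of the boundary of a vertex disc between consecutive half-edges,
* one of the two free sides of an edge disc in `A`, or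
* the attaching segment of an edge of `G` not in `A`. -/
inductive BoundaryStep (Q : G.SpanningSubgraph) : (E × Bool) × Bool → (E × Bool) × Bool → Prop
  | arc (h : E × Bool) : BoundaryStep Q (h, true) (G.rot h, false)
  | side (e : E) (he : e ∈ Q.edges) (b s : Bool) :
      BoundaryStep Q ((e, b), s) ((e, !b), xor s (!G.twisted e))
  | segment (e : E) (he : e ∉ Q.edges) (b : Bool) : BoundaryStep Q ((e, b), false) ((e, b), true)

/-- The boundary components of the surface `Q`: those that pass through corners, together with
the whole boundary circle of each vertex disc to which no edge of `G` is attached. -/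
def BoundaryComponent (Q : G.SpanningSubgraph) : Type _ :=
  Quot Q.BoundaryStep ⊕ {v : V // ∀ h, G.vert h ≠ v}

/-- The number `f(Q)` of boundary components. -/
noncomputable def f (Q : G.SpanningSubgraph) : ℕ := Nat.card Q.BoundaryComponent

/-- The connected component on which a boundary component lies. -/
def BoundaryComponent.component {Q : G.SpanningSubgraph} : Q.BoundaryComponent → Q.Component :=
  Sum.elim
    (Quot.lift (fun c => Quot.mk _ (G.vert c.1)) (by
      intro c c' hcc'
      cases hcc' with
      | arc h => rw [G.vert_rot]
      | side e he b s =>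
        cases b
        · exact Quot.sound ⟨e, he, rfl, rfl⟩
        · exact (Quot.sound ⟨e, he, rfl, rfl⟩).symm
      | segment e he b => rfl))
    (fun v => Quot.mk _ v.1)

/-- `Q` is a spanning quasi-tree of `G`: it has as many connected components as `G`, and each of
them has exactly one boundary component. -/
def IsQuasiTree [Fintype E] (Q : G.SpanningSubgraph) : Prop :=
  Q.k = G.whole.k ∧ ∀ c : Q.Component, ∃! b : Q.BoundaryComponent, b.component = c

/-- A forest: every edge is a bridge, that is, deleting it increases the number of connected
components. -/
def IsForest [DecidableEq E] (Q : G.SpanningSubgraph) : Prop :=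
  ∀ e ∈ Q.edges, Q.k < (⟨Q.edges.erase e⟩ : G.SpanningSubgraph).k

/-- A maximal spanning forest: a spanning forest not properly contained in another one. -/
def IsMaximalForest [DecidableEq E] (Q : G.SpanningSubgraph) : Prop :=
  Q.IsForest ∧ ∀ Q' : G.SpanningSubgraph, Q'.IsForest → Q.edges ⊆ Q'.edges → Q' = Q

/-! Capping off each boundary component of `Q` with a disc gives a closed surface, with a cell
structure that has the vertices as 0-cells, the edges of `Q` as 1-cells and the capping discs as
2-cells. The following is its cellular chain complex over `ℤ/2ℤ`. -/

/-- The boundary of an edge is the sum of its two ends. -/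
def boundaryOne [DecidableEq V] (Q : G.SpanningSubgraph) :
    (Q.edges → ZMod 2) →ₗ[ZMod 2] (V → ZMod 2) where
  toFun x := ∑ e, (Pi.single (G.vert (e.1, false)) (x e) + Pi.single (G.vert (e.1, true)) (x e))
  map_add' x y := by
    simp only [Pi.add_apply, Pi.single_add, ← Finset.sum_add_distrib]
    exact Finset.sum_congr rfl fun _ _ => by abel
  map_smul' r x := by
    simp only [Pi.smul_apply, Pi.single_smul, RingHom.id_apply, Finset.smul_sum, smul_add]

/-- The boundary component of `Q` (hence the 2-cell) that passes through a given corner. -/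
def boundaryAt (Q : G.SpanningSubgraph) (c : (E × Bool) × Bool) : Q.BoundaryComponent :=
  Sum.inl (Quot.mk _ c)

/-- The boundary of a 2-cell is the sum of the edges on it, counted with multiplicity: the
coefficient of `e` in the boundary of the chain `x` is the sum of the coefficients in `x` of the
2-cells at the two sides of `e`, which start at the corners `((e, false), false)` and
`((e, false), true)`. -/
def boundaryTwo (Q : G.SpanningSubgraph) :
    (Q.BoundaryComponent → ZMod 2) →ₗ[ZMod 2] (Q.edges → ZMod 2) where
  toFun x e := x (Q.boundaryAt ((e.1, false), false)) + x (Q.boundaryAt ((e.1, false), true))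
  map_add' x y := by funext e; simp only [Pi.add_apply]; abel
  map_smul' r x := by funext e; simp only [Pi.smul_apply, RingHom.id_apply, smul_add]

/-- The two boundary maps form a chain complex. -/
theorem boundaryOne_boundaryTwo [Fintype E] [DecidableEq V] (Q : G.SpanningSubgraph)
    (x : Q.BoundaryComponent → ZMod 2) : Q.boundaryOne (Q.boundaryTwo x) = 0 := by
  classical
  funext w
  have hz : ∀ a : ZMod 2, a + a = 0 := by decide
  set p : (E × Bool) × Bool → ZMod 2 := fun c => x (Q.boundaryAt c) with hp
  have hstep : ∀ c c', Q.BoundaryStep c c' → p c = p c' := fun c c' h =>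
    congrArg x (congrArg Sum.inl (Quot.sound h))
  have hsum : ∑ h : E × Bool, (if G.vert h = w then p (h, false) + p (h, true) else 0) = 0 := by
    have h1 : ∑ h : E × Bool, (if G.vert h = w then p (h, false) else 0) =
        ∑ h : E × Bool, (if G.vert h = w then p (h, true) else 0) := by
      rw [← Equiv.sum_comp G.rot]
      refine Finset.sum_congr rfl fun h _ => ?_
      rw [G.vert_rot, hstep _ _ (BoundaryStep.arc h)]
    have h2 : ∀ h : E × Bool, (if G.vert h = w then p (h, false) + p (h, true) else 0) =
        (if G.vert h = w then p (h, false) else 0) + (if G.vert h = w then p (h, true) else 0) := by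
      intro h; split_ifs <;> simp
    rw [Finset.sum_congr rfl fun h _ => h2 h, Finset.sum_add_distrib, h1, hz]
  rw [Fintype.sum_prod_type, ← Finset.sum_subset (Finset.subset_univ Q.edges)] at hsum
  · rw [Pi.zero_apply, ← hsum, ← Finset.sum_coe_sort Q.edges]
    simp only [boundaryOne, LinearMap.coe_mk, AddHom.coe_mk, Finset.sum_apply]
    refine Finset.sum_congr rfl fun e _ => ?_
    have hside : p ((e.1, true), false) + p ((e.1, true), true) =
        p ((e.1, false), false) + p ((e.1, false), true) := by
      rw [hstep _ _ (BoundaryStep.side e.1 e.2 true false),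
        hstep _ _ (BoundaryStep.side e.1 e.2 true true)]
      cases G.twisted e.1 <;> simp [add_comm]
    have htwo : Q.boundaryTwo x e = p ((e.1, false), false) + p ((e.1, false), true) := rfl
    rw [Fintype.sum_bool, hside, htwo, Pi.add_apply, Pi.single_apply, Pi.single_apply, add_comm]
    simp only [eq_comm]
  · intro e _ he
    refine Finset.sum_eq_zero fun b _ => ?_
    rw [hstep _ _ (BoundaryStep.segment e he b), hz, ite_self]

/-- The Euler genus `γ(Q)`, as the dimension of the first homology group with coefficients in
`ℤ/2ℤ` of the closed surface obtained by capping off the boundary components of `Q`. This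
dimension is `2g` for the orientable surface of genus `g`, it is `g` for the non-orientable surface
of genus `g`, and it is additive over connected components. -/
noncomputable def eulerGenus [DecidableEq V] (Q : G.SpanningSubgraph) : ℕ :=
  Module.finrank (ZMod 2)
    (LinearMap.ker Q.boundaryOne ⧸
      (LinearMap.range Q.boundaryTwo).comap (LinearMap.ker Q.boundaryOne).subtype)

end SpanningSubgraph

/-- The number `v(G)` of vertices. -/
def v [Fintype V] (_G : RibbonGraph V E) : ℕ := Fintype.card V

/-- The number `k(G)` of connected components. -/
noncomputable def k [Fintype E] (G : RibbonGraph V E) : ℕ := G.whole.k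

/-- The Euler genus `γ(G)`. -/
noncomputable def eulerGenus [Fintype E] [DecidableEq V] (G : RibbonGraph V E) : ℕ :=
  G.whole.eulerGenus

/-- `D(G)`: the feasible sets are the edge sets of the spanning quasi-trees of `G`. -/
def deltaMatroid [Fintype E] (G : RibbonGraph V E) : SetSystem E :=
  ⟨{F | ∃ Q : G.SpanningSubgraph, Q.IsQuasiTree ∧ Q.edges = F}⟩

end RibbonGraph

/-! Everything is governed by the number f of boundary components. Every connected component carries
a boundary component, so k(G) ≤ k(Q) ≤ f(Q), and the quasi-trees are exactly the Q with f(Q) = k(G),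
the least possible value (`isQuasiTree_iff`).

The local analysis takes place at one edge e. Its four corners form a torsor under (ℤ/2)² (`shift`),
whose three nonzero elements are the three ways to join them in pairs. Absence of e selects one
pairing; presence selects one of the other two, depending on the twist. Outside e the boundary
consists of closed circles and two paths, which join the corners by some pairing t₀
(`exists_shift_joined_iff`). If the pairing selected at e is t₀, two circles pass through e;
otherwise only one does. So toggling e changes f by at most one, and lowers it by one if e meets two
boundary components (`exists_pairing_of_toggle`).

Exchange: let Z be X toggled at u. If Z is not feasible, then f(Z) = k(G) + 1. If no other edge of X
∆ Y met two boundary components of Z, each boundary circle of Y would lie within one of Z, giving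
f(Z) ≤ f(Y) = k(G), which is absurd. Toggling an edge that does meet two of them restores
feasibility.

Cardinalities: the ranks of the two boundary maps give Euler's formula γ + v + f = |A| + 2k, which
turns cardinalities of quasi-trees into genera. Maximal forests are the smallest feasible sets.
Deleting from G edges that meet two boundary components yields the largest ones.

Parity: an orientation gives a 2-colouring of corners that alternates along every pairing in use.
This rules out that t₀ is the third, unused pairing, so every toggle changes f by exactly one.
Conversely, if D is even, toggling any edge of a forest quasi-tree raises f; the alternating
colouring of its boundary then alternates along all pairings in use, and it yields an orientation.
-/

/-! ## Counting classes of generated equivalence relations -/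

section Quotients

variable {α : Type*}

/-- Quotients by coarser relations are smaller. -/
theorem card_quot_le_card_quot [Finite α] {r s : α → α → Prop}
    (h : ∀ x y, r x y → Quot.mk s x = Quot.mk s y) : Nat.card (Quot s) ≤ Nat.card (Quot r) :=
  Nat.card_le_card_of_surjective (Quot.lift (Quot.mk s) h)
    (by rintro ⟨x⟩; exact ⟨Quot.mk _ x, rfl⟩)

/-- Identifications in a quotient persist in the quotient by a coarser relation. -/
theorem quot_mk_eq_of_le {r s : α → α → Prop}
    (h : ∀ x y, r x y → Quot.mk s x = Quot.mk s y) {x y : α} (hxy : Quot.mk r x = Quot.mk r y) :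
    Quot.mk s x = Quot.mk s y :=
  congrArg (Quot.lift (Quot.mk s) h) hxy

/-- Joining two distinct classes lowers the number of classes by one. -/
theorem card_quot_add_one [Finite α] {r s : α → α → Prop} {a b : α}
    (hrs : ∀ x y, r x y → Quot.mk s x = Quot.mk s y) (hab : Quot.mk s a = Quot.mk s b)
    (hsr : ∀ x y, s x y → Quot.mk r x = Quot.mk r y ∨
      (Quot.mk r x = Quot.mk r a ∧ Quot.mk r y = Quot.mk r b) ∨
      (Quot.mk r x = Quot.mk r b ∧ Quot.mk r y = Quot.mk r a))
    (hne : Quot.mk r a ≠ Quot.mk r b) : Nat.card (Quot s) + 1 = Nat.card (Quot r) := by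
  classical
  have key : Quot s ≃ {q : Quot r // q ≠ Quot.mk r b} :=
    { toFun := Quot.lift
        (fun x => if h : Quot.mk r x = Quot.mk r b then ⟨Quot.mk r a, hne⟩ else ⟨Quot.mk r x, h⟩)
        (by
          intro x y hxy
          rcases hsr x y hxy with h | ⟨h1, h2⟩ | ⟨h1, h2⟩
          · simp only [h]
          · simp only [h1, h2, hne, dite_true, dite_false]
          · simp only [h1, h2, hne, dite_true, dite_false])
      invFun := fun q => Quot.lift (Quot.mk s) hrs q.1
      left_inv := by
        rintro ⟨x⟩
        by_cases h : Quot.mk r x = Quot.mk r b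
        · simp only [h, dite_true]
          exact hab.trans (quot_mk_eq_of_le hrs h.symm)
        · simp only [h, dite_false]
      right_inv := by
        rintro ⟨⟨x⟩, hx⟩
        simp only [dif_neg hx] }
  have : Fintype (Quot r) := Fintype.ofFinite _
  rw [Nat.card_congr key, Nat.card_eq_fintype_card, Nat.card_eq_fintype_card,
    Fintype.card_subtype_compl, Fintype.card_subtype_eq]
  have : 0 < Fintype.card (Quot r) := Fintype.card_pos_iff.2 ⟨Quot.mk r a⟩
  omega

end Quotients

/-! ## Alternating colourings of pairs of fixed-point-free involutions -/

/-- Two involutions without fixed points admit a colouring with two colours that both of them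
reverse. -/
theorem exists_alternating_coloring {C : Type*} {α β : C → C} (hα : Function.Involutive α)
    (hβ : Function.Involutive β) (hα' : ∀ x, α x ≠ x) (hβ' : ∀ x, β x ≠ x) :
    ∃ c : C → Bool, ∀ x, c (α x) = !c x ∧ c (β x) = !c x := by
  classical
  set p : Equiv.Perm C := hα.toPerm with hp
  set q : Equiv.Perm C := hβ.toPerm with hq
  have hpp : p * p = 1 := Equiv.ext fun x => hα x
  have hqq : q * q = 1 := Equiv.ext fun x => hβ x
  have hpi : p⁻¹ = p := inv_eq_of_mul_eq_one_left hpp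
  have hqi : q⁻¹ = q := inv_eq_of_mul_eq_one_left hqq
  set σ : Equiv.Perm C := p * q with hσ
  have hconj : ∀ n : ℤ, p * σ ^ n = σ ^ (-n) * p := by
    intro n
    have h1 : p * σ * p⁻¹ = σ⁻¹ := by
      rw [hσ, mul_inv_rev, hpi, hqi, ← mul_assoc, hpp, one_mul]
    have h2 : p * σ ^ n * p⁻¹ = σ ^ (-n) := by rw [← conj_zpow, h1, inv_zpow, zpow_neg]
    rw [← h2, inv_mul_cancel_right]
  -- In the dihedral group generated by `p` and `q`, each `p * σ ^ n` is conjugate to `p` or to `q`,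
  -- so it has no fixed point.
  have hns : ∀ x, ¬ σ.SameCycle x (α x) := by
    rintro x ⟨n, hn⟩
    rcases Int.even_or_odd' n with ⟨m, rfl | rfl⟩
    · apply hα' ((σ ^ m) x)
      have h1 : (p * σ ^ m) x = (σ ^ (-m) * p) x := by rw [hconj]
      have h2 : p x = (σ ^ (2 * m)) x := hn.symm
      calc α ((σ ^ m) x) = (p * σ ^ m) x := rfl
        _ = (σ ^ (-m)) (p x) := h1
        _ = (σ ^ (-m) * σ ^ (2 * m)) x := by rw [h2]; rfl
        _ = (σ ^ m) x := by rw [← zpow_add]; congr 2; ring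
    · apply hβ' ((σ ^ m) x)
      have h1 : q = p * σ := by rw [hσ, ← mul_assoc, hpp, one_mul]
      have h2 : p x = (σ ^ (2 * m + 1)) x := hn.symm
      calc β ((σ ^ m) x) = (q * σ ^ m) x := rfl
        _ = (p * σ ^ (m + 1)) x := by rw [h1, mul_assoc, ← zpow_one_add, add_comm]
        _ = (σ ^ (-(m + 1)) * p) x := by rw [hconj]
        _ = (σ ^ (-(m + 1)) * σ ^ (2 * m + 1)) x := by
          rw [Equiv.Perm.mul_apply, h2]; rfl
        _ = (σ ^ m) x := by rw [← zpow_add]; congr 2; ring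
  let S : Setoid C := Equiv.Perm.SameCycle.setoid σ
  let cls : C → Quotient S := Quotient.mk S
  -- Both involutions exchange the `σ`-cycle of `x` with the different `σ`-cycle of `α x`. An
  -- arbitrary linear order on cycles picks a colour within each such pair.
  let _ : LinearOrder (Quotient S) := linearOrderOfSTO WellOrderingRel
  have hne : ∀ x, cls x ≠ cls (α x) := fun x h => hns x (Quotient.exact h)
  have hβα : ∀ x, cls (β x) = cls (α x) := fun x =>
    Quotient.sound (show σ.SameCycle (β x) (α x) from ⟨1, by
      rw [zpow_one]; exact congrArg α (hβ x)⟩)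
  have hαβ : ∀ x, cls (α (β x)) = cls x := fun x =>
    Quotient.sound (show σ.SameCycle (α (β x)) x from ⟨-1, by
      rw [zpow_neg_one]; exact σ.symm_apply_apply x⟩)
  refine ⟨fun x => decide (cls x < cls (α x)), fun x => ?_⟩
  have h := hne x
  constructor
  · beta_reduce
    rw [hα x, ← decide_not, decide_eq_decide, not_lt]
    exact ⟨le_of_lt, fun h' => lt_of_le_of_ne h' h.symm⟩
  · beta_reduce
    rw [hβα x, hαβ x, ← decide_not, decide_eq_decide, not_lt]
    exact ⟨le_of_lt, fun h' => lt_of_le_of_ne h' h.symm⟩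

/-! ## States and their circles -/

namespace RibbonGraph

variable {V E : Type*}

/-- Move a corner to another corner of the same edge: `t.1` tells whether to change the half-edge,
and `t.2` whether to change the end of the half-edge. -/
def shift (t : Bool × Bool) (c : (E × Bool) × Bool) : (E × Bool) × Bool :=
  ((c.1.1, xor c.1.2 t.1), xor c.2 t.2)

@[simp]
theorem shift_fst_fst (t : Bool × Bool) (c : (E × Bool) × Bool) : (shift t c).1.1 = c.1.1 := rfl

theorem shift_shift (t t' : Bool × Bool) (c : (E × Bool) × Bool) :
    shift t (shift t' c) = shift (xor t.1 t'.1, xor t.2 t'.2) c := by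
  obtain ⟨⟨e, b⟩, s⟩ := c
  obtain ⟨t1, t2⟩ := t
  obtain ⟨t1', t2'⟩ := t'
  cases b <;> cases s <;> cases t1 <;> cases t2 <;> cases t1' <;> cases t2' <;> rfl

theorem shift_involutive (t : Bool × Bool) :
    Function.Involutive (shift t : (E × Bool) × Bool → _) := by
  rintro ⟨⟨e, b⟩, s⟩
  simp [shift]

theorem shift_ne {t : Bool × Bool} (ht : t ≠ (false, false)) (c : (E × Bool) × Bool) :
    shift t c ≠ c := by
  obtain ⟨⟨e, b⟩, s⟩ := c
  obtain ⟨t1, t2⟩ := t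
  revert ht
  cases b <;> cases s <;> cases t1 <;> cases t2 <;> simp [shift]

/-- Any corner of an edge is a shift of any other one. -/
theorem exists_shift_eq {c c' : (E × Bool) × Bool} (h : c.1.1 = c'.1.1) :
    ∃ t, c' = shift t c := by
  obtain ⟨⟨e, b⟩, s⟩ := c
  obtain ⟨⟨e', b'⟩, s'⟩ := c'
  obtain rfl : e = e' := h
  exact ⟨(xor b b', xor s s'), by cases b <;> cases s <;> cases b' <;> cases s' <;> rfl⟩

/-- The other end of the arc of a vertex boundary that starts at a corner. -/
def arcEnd (G : RibbonGraph V E) (c : (E × Bool) × Bool) : (E × Bool) × Bool :=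
  if c.2 then (G.rot c.1, false) else (G.rot.symm c.1, true)

theorem arcEnd_involutive (G : RibbonGraph V E) : Function.Involutive G.arcEnd := by
  rintro ⟨h, s⟩
  cases s <;> simp [arcEnd]

theorem arcEnd_ne (G : RibbonGraph V E) (c : (E × Bool) × Bool) : G.arcEnd c ≠ c := by
  obtain ⟨h, s⟩ := c
  cases s <;> simp [arcEnd]

/-- A state `s` assigns to each edge `e` the way in which its four corners are joined in pairs. This
is the resulting pairing of the corners. -/
def pairing (s : E → Bool × Bool) (c : (E × Bool) × Bool) : (E × Bool) × Bool :=
  shift (s c.1.1) c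

theorem pairing_involutive (s : E → Bool × Bool) : Function.Involutive (pairing s) :=
  fun c => shift_involutive (s c.1.1) c

/-- Two corners are joined by an arc of a vertex boundary, or by the state `s` at an edge. -/
def StateStep (G : RibbonGraph V E) (s : E → Bool × Bool) (c c' : (E × Bool) × Bool) : Prop :=
  c' = G.arcEnd c ∨ c' = pairing s c

/-- Two corners are joined by an arc of a vertex boundary, or by the state `s` at an edge other
than `e`. -/
def StateStepOff (G : RibbonGraph V E) (s : E → Bool × Bool) (e : E)
    (c c' : (E × Bool) × Bool) : Prop :=
  c' = G.arcEnd c ∨ (c.1.1 ≠ e ∧ c' = pairing s c)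

theorem exists_coloring (G : RibbonGraph V E) {s : E → Bool × Bool}
    (hs : ∀ e, s e ≠ (false, false)) :
    ∃ c : (E × Bool) × Bool → Bool, ∀ x, c (G.arcEnd x) = !c x ∧ c (pairing s x) = !c x :=
  exists_alternating_coloring G.arcEnd_involutive (pairing_involutive s) G.arcEnd_ne
    fun x => shift_ne (hs x.1.1) x

theorem stateStepOff_congr (G : RibbonGraph V E) {s s' : E → Bool × Bool} {e : E}
    (h : ∀ e', e' ≠ e → s e' = s' e') : G.StateStepOff s e = G.StateStepOff s' e := by
  funext c c'
  unfold StateStepOff pairing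
  by_cases hc : c.1.1 = e
  · simp [hc]
  · rw [h _ hc]

/-- Two alternating colourings agree, up to a change of the colours, on corners that are joined. -/
theorem coloring_eq_iff_of_joined (G : RibbonGraph V E) {s : E → Bool × Bool} {e : E}
    {c c' : (E × Bool) × Bool → Bool}
    (hc : ∀ x, c (G.arcEnd x) = !c x) (hc' : ∀ x, c' (G.arcEnd x) = !c' x)
    (hcs : ∀ x, x.1.1 ≠ e → c (pairing s x) = !c x)
    (hcs' : ∀ x, x.1.1 ≠ e → c' (pairing s x) = !c' x)
    {x y : (E × Bool) × Bool}
    (hxy : Quot.mk (G.StateStepOff s e) x = Quot.mk (G.StateStepOff s e) y) :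
    c x = c y ↔ c' x = c' y := by
  have h : xor (c x) (c' x) = xor (c y) (c' y) := by
    refine congrArg (Quot.lift (fun z => xor (c z) (c' z)) ?_) hxy
    rintro z w (rfl | ⟨hz, rfl⟩)
    · rw [hc, hc']; cases c z <;> cases c' z <;> rfl
    · rw [hcs _ hz, hcs' _ hz]; cases c z <;> cases c' z <;> rfl
  revert h
  cases c x <;> cases c' x <;> cases c y <;> cases c' y <;> simp

/-- The number of corners of `e` in a class is even. -/
theorem sum_corners_eq_zero [Fintype E] (G : RibbonGraph V E) {s : E → Bool × Bool} {e : E}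
    (hs : ∀ e', e' ≠ e → s e' ≠ (false, false)) (p : (E × Bool) × Bool → Prop) [DecidablePred p]
    (hp : ∀ x y, G.StateStepOff s e x y → (p x ↔ p y)) :
    ∑ t : Bool × Bool, (if p (shift t ((e, false), false)) then (1 : ZMod 2) else 0) = 0 := by
  classical
  have h11 : (1 : ZMod 2) + 1 = 0 := by decide
  -- The fixed-point-free involution `arcEnd` preserves `p` on all corners, and `pairing s`
  -- preserves it on the corners off `e`. Both counts are even, hence so is their difference.
  have h1 : ∑ x : (E × Bool) × Bool, (if p x then (1 : ZMod 2) else 0) = 0 := by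
    refine Finset.sum_involution (fun x _ => G.arcEnd x) ?_ ?_ ?_ ?_
    · intro x _
      have := hp x _ (Or.inl rfl)
      by_cases h : p x
      · rw [if_pos h, if_pos (this.1 h), h11]
      · rw [if_neg h, if_neg (fun h' => h (this.2 h')), add_zero]
    · intro x _ _; exact G.arcEnd_ne x
    · intro x _; exact Finset.mem_univ _
    · intro x _; exact G.arcEnd_involutive x
  have h2 : ∑ x : (E × Bool) × Bool,
      (if x.1.1 ≠ e ∧ p x then (1 : ZMod 2) else 0) = 0 := by
    refine Finset.sum_involution (fun x _ => pairing s x) ?_ ?_ ?_ ?_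
    · intro x _
      by_cases hx : x.1.1 = e
      · simp [hx, pairing]
      · have := hp x _ (Or.inr ⟨hx, rfl⟩)
        by_cases h : p x
        · rw [if_pos ⟨hx, h⟩, if_pos ⟨hx, this.1 h⟩, h11]
        · rw [if_neg (fun h' => h h'.2), if_neg (fun h' => h (this.2 h'.2)), add_zero]
    · intro x _ h
      have hx : x.1.1 ≠ e := by
        by_contra hx; simp [hx] at h
      exact shift_ne (hs _ hx) x
    · intro x _; exact Finset.mem_univ _
    · intro x _; exact pairing_involutive s x
  have h3 : ∑ x : (E × Bool) × Bool, (if x.1.1 = e ∧ p x then (1 : ZMod 2) else 0) = 0 := by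
    have h4 : ∑ x : (E × Bool) × Bool, (if p x then (1 : ZMod 2) else 0) =
        ∑ x : (E × Bool) × Bool, (if x.1.1 = e ∧ p x then (1 : ZMod 2) else 0) +
          ∑ x : (E × Bool) × Bool, (if x.1.1 ≠ e ∧ p x then (1 : ZMod 2) else 0) := by
      rw [← Finset.sum_add_distrib]
      refine Finset.sum_congr rfl fun x _ => ?_
      by_cases hx : x.1.1 = e <;> by_cases h : p x <;> simp [hx, h]
    rwa [h1, h2, add_zero, eq_comm] at h4
  refine (Finset.sum_of_injOn (fun t => shift t ((e, false), false)) ?_ ?_ ?_ ?_).trans h3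
  · rintro ⟨a, b⟩ _ ⟨a', b'⟩ _ h
    simpa [shift] using h
  · intro t _; simp
  · rintro x _ hx
    refine if_neg fun h => hx ?_
    obtain ⟨t, ht⟩ := exists_shift_eq (c := ((e, false), false)) h.1.symm
    exact ⟨t, by simp, ht.symm⟩
  · intro t _
    simp

end RibbonGraph

/-! ### Paths outside an edge, and the number of circles of a state -/

namespace RibbonGraph

variable {V E : Type*}

/-- Two distinct nonzero elements generate the Klein four-group. -/
theorem eq_or_eq_or_eq_xor {p q : Bool × Bool} (hp : p ≠ (false, false)) (hq : q ≠ (false, false))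
    (hpq : p ≠ q) (t : Bool × Bool) :
    t = (false, false) ∨ t = p ∨ t = q ∨ t = (xor p.1 q.1, xor p.2 q.2) := by
  have h : ∀ p q t : Bool × Bool, (p ≠ (false, false) ∧ q ≠ (false, false) ∧ p ≠ q) →
      t = (false, false) ∨ t = p ∨ t = q ∨ t = (xor p.1 q.1, xor p.2 q.2) := by decide
  exact h p q t ⟨hp, hq, hpq⟩

/-- An equivalence relation on four elements, with more than one class, all classes of which are
even, pairs the elements. -/
theorem exists_pairing_of_even {R : Bool × Bool → Bool × Bool → Prop} (hR : Equivalence R)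
    (heven : ∀ u, ∀ [DecidablePred (R u)], ∑ t, (if R u t then (1 : ZMod 2) else 0) = 0)
    (hne : ∃ t, ¬ R (false, false) t) :
    ∃ t₀, t₀ ≠ (false, false) ∧ ∀ u w, R u w ↔ w = u ∨ w = (xor t₀.1 u.1, xor t₀.2 u.2) := by
  classical
  -- The class of the zero element is nonempty, even and not everything, so it has exactly two
  -- elements.
  obtain ⟨t₀, ht₀, h0, h1⟩ : ∃ t₀, t₀ ≠ (false, false) ∧ R (false, false) t₀ ∧
      ∀ t, R (false, false) t → t = (false, false) ∨ t = t₀ := by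
    have h := heven (false, false)
    rw [Fintype.sum_prod_type] at h
    simp only [Fintype.sum_bool, if_pos (hR.refl (false, false))] at h
    obtain ⟨⟨t1, t2⟩, ht⟩ := hne
    have hr := hR.refl (false, false)
    by_cases p1 : R (false, false) (false, true) <;>
    by_cases p2 : R (false, false) (true, false) <;>
    by_cases p3 : R (false, false) (true, true) <;>
    simp only [p1, p2, p3, if_true, if_false] at h
    · cases t1 <;> cases t2 <;> contradiction
    · exact absurd h (by decide)
    · exact absurd h (by decide)
    · refine ⟨_, ?_, p1, ?_⟩ <;> simp [p2, p3]
    · exact absurd h (by decide)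
    · refine ⟨_, ?_, p2, ?_⟩ <;> simp [p1, p3]
    · refine ⟨_, ?_, p3, ?_⟩ <;> simp [p1, p2]
    · exact absurd h (by decide)
  refine ⟨t₀, ht₀, ?_⟩
  have hcases : ∀ t₀ : Bool × Bool, t₀ ≠ (false, false) → ∀ u : Bool × Bool,
      u = (false, false) ∨ u = t₀ ∨ ((u ≠ (false, false) ∧ u ≠ t₀) ∧
        ∀ t, t = u ∨ t = (false, false) ∨ t = t₀ ∨ t = (xor t₀.1 u.1, xor t₀.2 u.2)) := by
    decide
  intro u w
  rcases hcases t₀ ht₀ u with rfl | rfl | ⟨⟨hu, hu'⟩, hall⟩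
  · simp only [Bool.xor_false, Prod.mk.eta]
    exact ⟨h1 w, by rintro (rfl | rfl); exacts [hR.refl _, h0]⟩
  · simp only [Bool.xor_self]
    refine ⟨fun h => (h1 w (hR.trans h0 h)).symm, ?_⟩
    rintro (rfl | rfl)
    exacts [hR.refl _, hR.symm h0]
  -- Outside the class of zero only two elements remain, and evenness forbids two singletons.
  · have n0 : ¬ R u (false, false) := fun h => (h1 u (hR.symm h)).elim hu hu'
    have n1 : ¬ R u t₀ := fun h => (h1 u (hR.trans h0 (hR.symm h))).elim hu hu'
    have n2 : R u (xor t₀.1 u.1, xor t₀.2 u.2) := by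
      by_contra n2
      have h := heven u
      have : ∀ t, (if R u t then (1 : ZMod 2) else 0) = if t = u then 1 else 0 := by
        intro t
        by_cases htu : t = u
        · rw [if_pos htu, if_pos (htu ▸ hR.refl _)]
        · rw [if_neg htu, if_neg]
          rcases hall t with rfl | rfl | rfl | rfl
          exacts [absurd rfl htu, n0, n1, n2]
      simp [this] at h
    constructor
    · intro h
      rcases hall w with rfl | rfl | rfl | rfl
      exacts [Or.inl rfl, absurd h n0, absurd h n1, Or.inr rfl]
    · rintro (rfl | rfl)
      exacts [hR.refl _, n2]

/-- Outside of an edge `e`, the circles of a state consist of closed circles and of paths that join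
the four corners of `e` in pairs. -/
theorem exists_shift_joined_iff [Finite E] (G : RibbonGraph V E) {s : E → Bool × Bool}
    (e : E) (hs : ∀ e', e' ≠ e → s e' ≠ (false, false)) :
    ∃ t₀, t₀ ≠ (false, false) ∧ ∀ x : (E × Bool) × Bool, x.1.1 = e → ∀ t,
      Quot.mk (G.StateStepOff s e) x = Quot.mk (G.StateStepOff s e) (shift t x) ↔
        t = (false, false) ∨ t = t₀ := by
  classical
  have : Fintype E := Fintype.ofFinite E
  set a : (E × Bool) × Bool := ((e, false), false) with ha
  let R : Bool × Bool → Bool × Bool → Prop := fun t t' =>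
    Quot.mk (G.StateStepOff s e) (shift t a) = Quot.mk (G.StateStepOff s e) (shift t' a)
  have hR : Equivalence R := ⟨fun _ => rfl, fun h => h.symm, fun h h' => h.trans h'⟩
  -- Filling in any pairing `t` at `e` gives a state without fixed points, hence a colouring that
  -- alternates off `e` and along `t`.
  have hcol : ∀ t, t ≠ (false, false) → ∃ c : (E × Bool) × Bool → Bool,
      (∀ x, c (G.arcEnd x) = !c x) ∧ (∀ x, x.1.1 ≠ e → c (pairing s x) = !c x) ∧
      ∀ x, x.1.1 = e → c (shift t x) = !c x := by
    intro t ht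
    obtain ⟨c, hc⟩ := G.exists_coloring (s := Function.update s e t) (fun e' => by
      by_cases h : e' = e
      · subst h; simpa using ht
      · simpa [h] using hs e' h)
    refine ⟨c, fun x => (hc x).1, fun x hx => ?_, fun x hx => ?_⟩
    · rw [← (hc x).2, pairing, pairing, Function.update_of_ne hx]
    · rw [← (hc x).2, pairing, hx, Function.update_self]
  obtain ⟨t₀, ht₀, h⟩ := exists_pairing_of_even hR (by
    intro u _
    convert G.sum_corners_eq_zero hs
      (fun y => Quot.mk (G.StateStepOff s e) (shift u a) = Quot.mk (G.StateStepOff s e) y) ?_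
    intro x y hxy
    rw [Quot.sound hxy]) (by
    -- If all four corners were joined outside `e`, these colourings would agree on them up to
    -- swapping colours. One colouring would then alternate along all three pairings, impossible
    -- with two colours.
    by_contra! hall
    obtain ⟨c, hc1, hc2, hc3⟩ := hcol (false, true) (by decide)
    have hca : ∀ t, t ≠ (false, false) → c (shift t a) = !c a := by
      intro t ht
      obtain ⟨c', hc1', hc2', hc3'⟩ := hcol t ht
      have h1 := coloring_eq_iff_of_joined G hc1 hc1' hc2 hc2' (hall t)
      have h2 := hc3' a rfl
      have h3 : shift (false, false) a = a := rfl
      rw [h3, h2] at h1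
      revert h1
      cases c a <;> cases c (shift t a) <;> cases c' a <;> simp
    have h1 := hca (true, false) (by decide)
    have h2 := hca (true, true) (by decide)
    have h3 : c (shift (true, true) a) = !c (shift (true, false) a) :=
      hc3 (shift (true, false) a) rfl
    rw [h1, h2] at h3
    cases c a <;> simp at h3)
  refine ⟨t₀, ht₀, fun x hx t => ?_⟩
  obtain ⟨u, rfl⟩ := exists_shift_eq (c := a) hx.symm
  rw [shift_shift]
  refine (h u _).trans ?_
  obtain ⟨u1, u2⟩ := u
  obtain ⟨t1, t2⟩ := t
  obtain ⟨s1, s2⟩ := t₀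
  cases u1 <;> cases u2 <;> simp [Prod.ext_iff]

/-- The number of circles of a state. -/
noncomputable def circles (G : RibbonGraph V E) (s : E → Bool × Bool) : ℕ :=
  Nat.card (Quot (G.StateStep s))

theorem quot_mk_eq_of_stateStepOff (G : RibbonGraph V E) {s : E → Bool × Bool} {e : E}
    {x y : (E × Bool) × Bool}
    (h : Quot.mk (G.StateStepOff s e) x = Quot.mk (G.StateStepOff s e) y) :
    Quot.mk (G.StateStep s) x = Quot.mk (G.StateStep s) y :=
  quot_mk_eq_of_le (fun _ _ h => Quot.sound (h.imp id And.right)) h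

/-- Pairing the corners as the outside paths already do closes up each path separately and merges no
classes. -/
theorem circles_eq_of_eq [Finite E] (G : RibbonGraph V E) {s : E → Bool × Bool} {e : E}
    {t₀ : Bool × Bool}
    (ht : ∀ x : (E × Bool) × Bool, x.1.1 = e → ∀ t,
      Quot.mk (G.StateStepOff s e) x = Quot.mk (G.StateStepOff s e) (shift t x) ↔
        t = (false, false) ∨ t = t₀)
    (hse : s e = t₀) :
    G.circles s = Nat.card (Quot (G.StateStepOff s e)) := by
  refine le_antisymm (card_quot_le_card_quot fun _ _ h => Quot.sound (h.imp id And.right))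
    (card_quot_le_card_quot ?_)
  rintro x y (h | h)
  · exact Quot.sound (Or.inl h)
  · by_cases hx : x.1.1 = e
    · rw [h, pairing, hx, hse]
      exact (ht x hx t₀).2 (Or.inr rfl)
    · exact Quot.sound (Or.inr ⟨hx, h⟩)

/-- Two different pairings generate all shifts, so a single circle runs through all four corners. -/
theorem joined_of_ne (G : RibbonGraph V E) {s : E → Bool × Bool} {e : E} {t₀ : Bool × Bool}
    (ht : ∀ x : (E × Bool) × Bool, x.1.1 = e → ∀ t,
      Quot.mk (G.StateStepOff s e) x = Quot.mk (G.StateStepOff s e) (shift t x) ↔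
        t = (false, false) ∨ t = t₀)
    (hs : s e ≠ (false, false)) (ht₀ : t₀ ≠ (false, false)) (hse : s e ≠ t₀)
    {x y : (E × Bool) × Bool} (hx : x.1.1 = e) (hy : y.1.1 = e) :
    Quot.mk (G.StateStep s) x = Quot.mk (G.StateStep s) y := by
  obtain ⟨t, rfl⟩ := exists_shift_eq (hx.trans hy.symm)
  have h1 : ∀ z : (E × Bool) × Bool, z.1.1 = e →
      Quot.mk (G.StateStep s) z = Quot.mk (G.StateStep s) (shift t₀ z) := fun z hz =>
    G.quot_mk_eq_of_stateStepOff ((ht z hz t₀).2 (Or.inr rfl))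
  have h2 : ∀ z : (E × Bool) × Bool, z.1.1 = e →
      Quot.mk (G.StateStep s) z = Quot.mk (G.StateStep s) (shift (s e) z) := fun z hz =>
    Quot.sound (Or.inr (by rw [pairing, hz]))
  rcases eq_or_eq_or_eq_xor hs ht₀ hse t with h | h | h | h
  · rw [h]; simp [shift]
  · rw [h]; exact h2 x hx
  · rw [h]; exact h1 x hx
  · rw [h, ← shift_shift]
    exact (h1 x hx).trans (h2 _ hx)

/-- A pairing other than that of the outside paths links the two paths into one circle. -/
theorem circles_add_one_of_ne [Finite E] (G : RibbonGraph V E) {s : E → Bool × Bool} {e : E}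
    {t₀ : Bool × Bool}
    (ht : ∀ x : (E × Bool) × Bool, x.1.1 = e → ∀ t,
      Quot.mk (G.StateStepOff s e) x = Quot.mk (G.StateStepOff s e) (shift t x) ↔
        t = (false, false) ∨ t = t₀)
    (hs : s e ≠ (false, false)) (ht₀ : t₀ ≠ (false, false))
    (hse : s e ≠ t₀) :
    G.circles s + 1 = Nat.card (Quot (G.StateStepOff s e)) := by
  set a : (E × Bool) × Bool := ((e, false), false) with ha
  have hne : Quot.mk (G.StateStepOff s e) a ≠ Quot.mk (G.StateStepOff s e) (shift (s e) a) := by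
    rw [Ne, ht a rfl]
    tauto
  refine card_quot_add_one (a := a) (b := shift (s e) a)
    (fun _ _ h => Quot.sound (h.imp id And.right)) (G.joined_of_ne ht hs ht₀ hse rfl rfl) ?_ hne
  have hrep : ∀ z : (E × Bool) × Bool, z.1.1 = e →
      Quot.mk (G.StateStepOff s e) z = Quot.mk (G.StateStepOff s e) a ∨
      Quot.mk (G.StateStepOff s e) z = Quot.mk (G.StateStepOff s e) (shift (s e) a) := by
    intro z hz
    obtain ⟨t, rfl⟩ := exists_shift_eq (c := a) hz.symm
    rcases eq_or_eq_or_eq_xor hs ht₀ hse t with h | h | h | h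
    · left; rw [h]; rfl
    · right; rw [h]
    · left; rw [h]; exact ((ht a rfl t₀).2 (Or.inr rfl)).symm
    · right; rw [h, Bool.xor_comm, Bool.xor_comm (s e).2, ← shift_shift]
      exact ((ht _ rfl t₀).2 (Or.inr rfl)).symm
  rintro x y (h | h)
  · exact Or.inl (Quot.sound (Or.inl h))
  · by_cases hx : x.1.1 = e
    · have hy : y.1.1 = e := by rw [h]; exact hx
      rcases hrep x hx with h1 | h1 <;> rcases hrep y hy with h2 | h2 <;> simp [h1, h2]
    · exact Or.inl (Quot.sound (Or.inr ⟨hx, h⟩))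

end RibbonGraph

/-! ## Boundary components of spanning ribbon subgraphs -/

namespace RibbonGraph

namespace SpanningSubgraph

variable {V E : Type*} {G : RibbonGraph V E}

section state

variable [DecidableEq E]

/-- The state whose circles are the boundary components of `Q`. -/
def state (Q : G.SpanningSubgraph) (e : E) : Bool × Bool :=
  if e ∈ Q.edges then (true, !G.twisted e) else (false, true)

theorem state_of_mem {Q : G.SpanningSubgraph} {e : E} (he : e ∈ Q.edges) :
    Q.state e = (true, !G.twisted e) := if_pos he

theorem state_of_notMem {Q : G.SpanningSubgraph} {e : E} (he : e ∉ Q.edges) :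
    Q.state e = (false, true) := if_neg he

theorem state_ne (Q : G.SpanningSubgraph) (e : E) : Q.state e ≠ (false, false) := by
  unfold state
  split_ifs <;> simp

theorem state_ne_state {Q Q' : G.SpanningSubgraph} {e : E}
    (he : e ∈ Q.edges ↔ e ∉ Q'.edges) : Q.state e ≠ Q'.state e := by
  unfold state
  by_cases h : e ∈ Q.edges
  · simp [h, he.1 h]
  · simp [h, not_not.1 (mt he.2 h)]

theorem quot_stateStep_eq_of_boundaryStep (Q : G.SpanningSubgraph) (x y : (E × Bool) × Bool)
    (h : Q.BoundaryStep x y) :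
    Quot.mk (G.StateStep Q.state) x = Quot.mk (G.StateStep Q.state) y := by
  refine Quot.sound ?_
  cases h with
  | arc h => exact Or.inl (by simp [arcEnd])
  | side e he b s => exact Or.inr (by simp [pairing, shift, state_of_mem he])
  | segment e he b => exact Or.inr (by simp [pairing, shift, state_of_notMem he])

theorem quot_boundaryStep_eq_of_stateStep (Q : G.SpanningSubgraph) (x y : (E × Bool) × Bool)
    (h : G.StateStep Q.state x y) : Quot.mk Q.BoundaryStep x = Quot.mk Q.BoundaryStep y := by
  obtain ⟨⟨e, b⟩, s⟩ := x
  rcases h with rfl | rfl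
  · cases s
    · have := Quot.sound (BoundaryStep.arc (Q := Q) (G.rot.symm (e, b)))
      simpa [arcEnd] using this.symm
    · exact Quot.sound (by simpa [arcEnd] using BoundaryStep.arc (Q := Q) (e, b))
  · by_cases he : e ∈ Q.edges
    · have := Quot.sound (BoundaryStep.side e he b s)
      simpa [pairing, shift, state_of_mem he] using this
    · have := Quot.sound (BoundaryStep.segment e he b)
      cases s
      · simpa [pairing, shift, state_of_notMem he] using this
      · simpa [pairing, shift, state_of_notMem he] using this.symm

theorem quot_boundaryStep_eq_iff (Q : G.SpanningSubgraph) {x y : (E × Bool) × Bool} :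
    Quot.mk Q.BoundaryStep x = Quot.mk Q.BoundaryStep y ↔
      Quot.mk (G.StateStep Q.state) x = Quot.mk (G.StateStep Q.state) y :=
  ⟨quot_mk_eq_of_le Q.quot_stateStep_eq_of_boundaryStep,
    quot_mk_eq_of_le Q.quot_boundaryStep_eq_of_stateStep⟩

theorem f_eq_circles_add [Finite V] [Finite E] (Q : G.SpanningSubgraph) :
    Q.f = G.circles Q.state + Nat.card {v : V // ∀ h, G.vert h ≠ v} := by
  have h : Nat.card (Quot Q.BoundaryStep) = G.circles Q.state :=
    le_antisymm (card_quot_le_card_quot Q.quot_boundaryStep_eq_of_stateStep)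
      (card_quot_le_card_quot Q.quot_stateStep_eq_of_boundaryStep)
  rw [f, BoundaryComponent, Nat.card_sum, h]

variable [Finite V] [Finite E]

/-- How the number of boundary components changes when an edge is deleted or added. Outside of the
edge, the boundary joins the corners of the edge in pairs; if `Q` joins them in the same way, then
`Q` has one boundary component more than if it does not. -/
theorem exists_pairing_of_toggle {Q Q' : G.SpanningSubgraph} {e : E}
    (hQ : ∀ e', e' ≠ e → (e' ∈ Q.edges ↔ e' ∈ Q'.edges)) :
    ∃ t₀ n, t₀ ≠ (false, false) ∧ (∀ x : (E × Bool) × Bool, x.1.1 = e → ∀ t,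
        Quot.mk (G.StateStepOff Q.state e) x = Quot.mk (G.StateStepOff Q.state e) (shift t x) ↔
          t = (false, false) ∨ t = t₀) ∧
      (Q.state e = t₀ → Q.f = n + 1) ∧ (Q.state e ≠ t₀ → Q.f = n ∧
        ∀ x y : (E × Bool) × Bool, x.1.1 = e → y.1.1 = e →
          Quot.mk Q.BoundaryStep x = Quot.mk Q.BoundaryStep y) ∧
      (Q'.state e = t₀ → Q'.f = n + 1) ∧ (Q'.state e ≠ t₀ → Q'.f = n) := by
  obtain ⟨t₀, ht₀, ht⟩ := G.exists_shift_joined_iff e (s := Q.state) fun e' _ => Q.state_ne e'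
  have hst : G.StateStepOff Q.state e = G.StateStepOff Q'.state e :=
    G.stateStepOff_congr fun e' he' => by simp only [state, hQ e' he']
  have ht' := ht
  rw [hst] at ht'
  have : Nonempty (Quot (G.StateStepOff Q.state e)) := ⟨Quot.mk _ ((e, false), false)⟩
  have hpos : 0 < Nat.card (Quot (G.StateStepOff Q.state e)) := Nat.card_pos
  -- `n` counts the circles with the two paths at `e` merged, plus the vertices without half-edges.
  -- Positivity of the class count makes the truncated subtraction exact.
  refine ⟨t₀, Nat.card (Quot (G.StateStepOff Q.state e)) - 1 +
    Nat.card {v : V // ∀ h, G.vert h ≠ v}, ht₀, ht, ?_, ?_, ?_, ?_⟩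
  · intro h
    have := G.circles_eq_of_eq ht h
    rw [f_eq_circles_add]; omega
  · intro h
    have := G.circles_add_one_of_ne ht (Q.state_ne e) ht₀ h
    refine ⟨by rw [f_eq_circles_add]; omega, fun x y hx hy => ?_⟩
    exact Q.quot_boundaryStep_eq_iff.2 (G.joined_of_ne ht (Q.state_ne e) ht₀ h hx hy)
  · intro h
    have := G.circles_eq_of_eq ht' h
    rw [← hst] at this
    rw [f_eq_circles_add]; omega
  · intro h
    have := G.circles_add_one_of_ne ht' (Q'.state_ne e) ht₀ h
    rw [← hst] at this
    rw [f_eq_circles_add]; omega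

theorem f_le_add_one {Q Q' : G.SpanningSubgraph} {e : E}
    (hQ : ∀ e', e' ≠ e → (e' ∈ Q.edges ↔ e' ∈ Q'.edges)) : Q.f ≤ Q'.f + 1 := by
  obtain ⟨t₀, n, -, -, h1, h2, h3, h4⟩ := exists_pairing_of_toggle hQ
  have a : Q.f ≤ n + 1 := by
    by_cases h : Q.state e = t₀
    · exact (h1 h).le
    · exact (h2 h).1.le.trans (Nat.le_succ n)
  have b : n ≤ Q'.f := by
    by_cases h : Q'.state e = t₀
    · exact (Nat.le_succ n).trans (h3 h).ge
    · exact (h4 h).ge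
  omega

/-- Deleting or adding an edge that meets two boundary components merges them. -/
theorem f_add_one_of_ne {Q Q' : G.SpanningSubgraph} {e : E}
    (hQ : ∀ e', e' ≠ e → (e' ∈ Q.edges ↔ e' ∈ Q'.edges)) (he : e ∈ Q.edges ↔ e ∉ Q'.edges)
    {x y : (E × Bool) × Bool} (hx : x.1.1 = e) (hy : y.1.1 = e)
    (hxy : Quot.mk Q.BoundaryStep x ≠ Quot.mk Q.BoundaryStep y) : Q'.f + 1 = Q.f := by
  obtain ⟨t₀, n, -, -, h1, h2, h3, h4⟩ := exists_pairing_of_toggle hQ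
  by_cases h : Q.state e = t₀
  · rw [h1 h, h4 fun h' => state_ne_state he (h.trans h'.symm)]
  · exact absurd ((h2 h).2 x y hx hy) hxy

end state

/-! ### Components -/

theorem component_surjective (Q : G.SpanningSubgraph) :
    Function.Surjective (BoundaryComponent.component : Q.BoundaryComponent → Q.Component) := by
  rintro ⟨v⟩
  by_cases h : ∀ h, G.vert h ≠ v
  · exact ⟨Sum.inr ⟨v, h⟩, rfl⟩
  · push Not at h
    obtain ⟨h, rfl⟩ := h
    exact ⟨Sum.inl (Quot.mk _ (h, false)), rfl⟩

instance [Finite V] (Q : G.SpanningSubgraph) : Finite Q.Component :=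
  inferInstanceAs (Finite (Quot Q.Joined))

instance [Finite V] [Finite E] (Q : G.SpanningSubgraph) : Finite Q.BoundaryComponent :=
  inferInstanceAs (Finite (Quot Q.BoundaryStep ⊕ {v : V // ∀ h, G.vert h ≠ v}))

theorem k_le_f [Finite V] [Finite E] (Q : G.SpanningSubgraph) : Q.k ≤ Q.f :=
  Nat.card_le_card_of_surjective _ Q.component_surjective

/-- A function on the boundary components that takes the same value at the two sides of each edge
of `Q` comes from a function on the connected components. -/
theorem exists_comp_component_eq {R : Type*} (Q : G.SpanningSubgraph) (x : Q.BoundaryComponent → R)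
    (hx : ∀ e ∈ Q.edges,
      x (Q.boundaryAt ((e, false), false)) = x (Q.boundaryAt ((e, false), true))) :
    ∃ y : Q.Component → R, ∀ b, y b.component = x b := by
  classical
  have hstep : ∀ c c', Q.BoundaryStep c c' → x (Q.boundaryAt c) = x (Q.boundaryAt c') :=
    fun c c' h => congrArg x (congrArg Sum.inl (Quot.sound h))
  -- Crossing an attaching segment does not change `x`: for an edge of `Q` by hypothesis, since its
  -- sides carry the values to the other half-edge (a twist affects only their order); otherwise
  -- because the segment itself lies on the boundary.
  have hends : ∀ h, x (Q.boundaryAt (h, false)) = x (Q.boundaryAt (h, true)) := by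
    rintro ⟨e, b⟩
    by_cases he : e ∈ Q.edges
    · cases b
      · exact hx e he
      · rw [hstep _ _ (BoundaryStep.side e he true false),
          hstep _ _ (BoundaryStep.side e he true true)]
        cases G.twisted e
        · exact (hx e he).symm
        · exact hx e he
    · exact hstep _ _ (BoundaryStep.segment e he b)
  have hrot : ∀ h, x (Q.boundaryAt (G.rot h, false)) = x (Q.boundaryAt (h, false)) := fun h => by
    rw [hends h, hstep _ _ (BoundaryStep.arc h)]
  have hpow : ∀ (n : ℕ) h,
      x (Q.boundaryAt ((G.rot ^ n) h, false)) = x (Q.boundaryAt (h, false)) := by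
    intro n
    induction n with
    | zero => intro h; rfl
    | succ n ih => intro h; rw [pow_succ, Equiv.Perm.mul_apply, ih, hrot]
  have hcyc : ∀ h h', G.vert h = G.vert h' →
      x (Q.boundaryAt (h, false)) = x (Q.boundaryAt (h', false)) := by
    intro h h' hh
    obtain ⟨n, hn⟩ := G.sameCycle_of_vert_eq h h' hh
    rcases Int.eq_nat_or_neg n with ⟨m, rfl | rfl⟩
    · rw [← hn, zpow_natCast, hpow]
    · have : h = (G.rot ^ m) h' := by
        rw [← hn, ← Equiv.Perm.mul_apply, zpow_neg, zpow_natCast, mul_inv_cancel,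
          Equiv.Perm.one_apply]
      rw [this, hpow]
  let y₀ : V → R := fun v =>
    if h : ∀ h, G.vert h ≠ v then x (Sum.inr ⟨v, h⟩)
    else x (Q.boundaryAt (Classical.choose (not_forall_not.1 h), false))
  have hy₀ : ∀ h, y₀ (G.vert h) = x (Q.boundaryAt (h, false)) := by
    intro h
    have hn : ¬ ∀ h', G.vert h' ≠ G.vert h := fun h' => h' h rfl
    simp only [y₀, dif_neg hn]
    exact hcyc _ _ (Classical.choose_spec (not_forall_not.1 hn))
  refine ⟨Quot.lift y₀ ?_, ?_⟩
  · rintro _ _ ⟨e, he, rfl, rfl⟩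
    rw [hy₀, hy₀, hstep _ _ (BoundaryStep.side e he false false)]
    cases G.twisted e
    · exact (hends _).symm
    · rfl
  · rintro (⟨⟨h, s⟩⟩ | ⟨v, hv⟩)
    · refine (hy₀ h).trans ?_
      cases s
      · rfl
      · exact hends h
    · change y₀ v = _
      simp only [y₀, dif_pos hv]

/-- If the two sides of each edge lie on the same boundary component, then there are as many
boundary components as connected components. -/
theorem f_eq_k_of_sides [Finite V] [Finite E] (Q : G.SpanningSubgraph)
    (h : ∀ e ∈ Q.edges, Quot.mk Q.BoundaryStep ((e, false), false) =
      Quot.mk Q.BoundaryStep ((e, false), true)) : Q.f = Q.k := by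
  obtain ⟨y, hy⟩ := Q.exists_comp_component_eq id fun e he => congrArg Sum.inl (h e he)
  refine le_antisymm
    (Nat.card_le_card_of_injective (BoundaryComponent.component (Q := Q)) ?_) Q.k_le_f
  exact Function.LeftInverse.injective hy

/-- Used contrapositively: corners on different connected components lie on different boundary
components. -/
theorem joined_of_boundary_eq {Q : G.SpanningSubgraph} {x y : (E × Bool) × Bool}
    (h : Quot.mk Q.BoundaryStep x = Quot.mk Q.BoundaryStep y) :
    Quot.mk Q.Joined (G.vert x.1) = Quot.mk Q.Joined (G.vert y.1) :=
  congrArg (fun b => BoundaryComponent.component (Q := Q) (Sum.inl b)) h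

theorem joined_mono {Q Q' : G.SpanningSubgraph} (h : Q.edges ⊆ Q'.edges) {u w : V}
    (huw : Quot.mk Q.Joined u = Quot.mk Q.Joined w) : Quot.mk Q'.Joined u = Quot.mk Q'.Joined w :=
  quot_mk_eq_of_le (fun _ _ ⟨e, he, h1, h2⟩ => Quot.sound ⟨e, h he, h1, h2⟩) huw

theorem k_le_k [Finite V] {Q Q' : G.SpanningSubgraph} (h : Q.edges ⊆ Q'.edges) : Q'.k ≤ Q.k :=
  card_quot_le_card_quot fun _ _ ⟨e, he, h1, h2⟩ => Quot.sound ⟨e, h he, h1, h2⟩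

theorem k_empty [Fintype V] : (⟨∅⟩ : G.SpanningSubgraph).k = Fintype.card V := by
  rw [← Nat.card_eq_fintype_card]
  refine (Nat.card_congr (Equiv.ofBijective (Quot.mk _) ⟨?_, Quot.mk_surjective⟩)).symm
  intro u w h
  refine congrArg (Quot.lift id ?_) h
  rintro _ _ ⟨e, he, -⟩
  simp at he

/-- A spanning ribbon subgraph is a quasi-tree if and only if it has as many boundary components as
the ribbon graph has connected components. -/
theorem isQuasiTree_iff [Finite V] [Fintype E] (Q : G.SpanningSubgraph) :
    Q.IsQuasiTree ↔ Q.f = G.k := by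
  have h1 : G.k ≤ Q.k := k_le_k (Finset.subset_univ _)
  have h2 := Q.k_le_f
  constructor
  · rintro ⟨hk, hb⟩
    rw [RibbonGraph.k, ← hk]
    exact Nat.card_congr (Equiv.ofBijective _
      ((Function.bijective_iff_existsUnique BoundaryComponent.component).2 hb))
  · intro h
    refine ⟨le_antisymm (h2.trans h.le) h1, ?_⟩
    rw [← Function.bijective_iff_existsUnique]
    have : Fintype Q.Component := Fintype.ofFinite _
    have : Fintype Q.BoundaryComponent := Fintype.ofFinite _
    refine (Fintype.bijective_iff_surjective_and_card _).2 ⟨Q.component_surjective, ?_⟩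
    rw [← Nat.card_eq_fintype_card, ← Nat.card_eq_fintype_card]
    exact le_antisymm (h.le.trans h1) h2

/-- Adding an edge that joins two connected components. -/
theorem k_insert_add_one [Finite V] [DecidableEq E] (A : Finset E) {e : E}
    (h : Quot.mk (⟨A⟩ : G.SpanningSubgraph).Joined (G.vert (e, false)) ≠
      Quot.mk (⟨A⟩ : G.SpanningSubgraph).Joined (G.vert (e, true))) :
    (⟨insert e A⟩ : G.SpanningSubgraph).k + 1 = (⟨A⟩ : G.SpanningSubgraph).k := by
  refine card_quot_add_one (a := G.vert (e, false)) (b := G.vert (e, true)) ?_ ?_ ?_ h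
  · rintro _ _ ⟨e', he', rfl, rfl⟩
    exact Quot.sound ⟨e', Finset.mem_insert_of_mem he', rfl, rfl⟩
  · exact Quot.sound ⟨e, Finset.mem_insert_self e A, rfl, rfl⟩
  · rintro _ _ ⟨e', he', rfl, rfl⟩
    rcases Finset.mem_insert.1 he' with rfl | he'
    · exact Or.inr (Or.inl ⟨rfl, rfl⟩)
    · exact Or.inl (Quot.sound ⟨e', he', rfl, rfl⟩)

/-- Adding an edge within a connected component. -/
theorem k_insert_of_joined [Finite V] [DecidableEq E] (A : Finset E) {e : E}
    (h : Quot.mk (⟨A⟩ : G.SpanningSubgraph).Joined (G.vert (e, false)) =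
      Quot.mk (⟨A⟩ : G.SpanningSubgraph).Joined (G.vert (e, true))) :
    (⟨insert e A⟩ : G.SpanningSubgraph).k = (⟨A⟩ : G.SpanningSubgraph).k := by
  refine le_antisymm (k_le_k (Finset.subset_insert e A)) (card_quot_le_card_quot ?_)
  rintro _ _ ⟨e', he', rfl, rfl⟩
  rcases Finset.mem_insert.1 he' with rfl | he'
  · exact h
  · exact Quot.sound ⟨e', he', rfl, rfl⟩

end SpanningSubgraph

end RibbonGraph

/-! ### Orientability, parity and the exchange property -/

namespace RibbonGraph

variable {V E : Type*}

/-- An alternating colouring gives different colours to corners of `e` that are joined outside of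
`e`. -/
theorem coloring_shift_of_joined (G : RibbonGraph V E) {s : E → Bool × Bool}
    {e : E} (hs : ∀ e', e' ≠ e → s e' ≠ (false, false)) {c : (E × Bool) × Bool → Bool}
    (hc : ∀ x, c (G.arcEnd x) = !c x) (hcs : ∀ x, x.1.1 ≠ e → c (pairing s x) = !c x)
    {t : Bool × Bool} (ht : t ≠ (false, false)) {x : (E × Bool) × Bool} (hx : x.1.1 = e)
    (hxt : Quot.mk (G.StateStepOff s e) x = Quot.mk (G.StateStepOff s e) (shift t x)) :
    c (shift t x) = !c x := by
  classical
  -- The colouring `c'` with the pairing `t` filled in at `e` separates the two corners, and `c`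
  -- agrees with it up to a swap on joined corners.
  obtain ⟨c', hc'⟩ := G.exists_coloring (s := Function.update s e t) (fun e' => by
    by_cases h : e' = e
    · subst h; simpa using ht
    · simpa [h] using hs e' h)
  have h1 := G.coloring_eq_iff_of_joined hc (fun x => (hc' x).1) hcs (fun y hy => by
    rw [← (hc' y).2, pairing, pairing, Function.update_of_ne hy]) hxt
  have h2 : c' (shift t x) = !c' x := by rw [← (hc' x).2, pairing, hx, Function.update_self]
  rw [h2] at h1
  revert h1
  cases c x <;> cases c (shift t x) <;> cases c' x <;> simp

namespace SpanningSubgraph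

variable {G : RibbonGraph V E} [DecidableEq E]

/-- In an orientable ribbon graph, deleting or adding an edge changes the parity of the number of
boundary components. -/
theorem f_toggle_of_orientable [Finite V] [Finite E] (hG : G.Orientable)
    {Q Q' : G.SpanningSubgraph} {e : E}
    (hQ : ∀ e', e' ≠ e → (e' ∈ Q.edges ↔ e' ∈ Q'.edges)) (he : e ∈ Q.edges ↔ e ∉ Q'.edges) :
    Q.f = Q'.f + 1 ∨ Q'.f = Q.f + 1 := by
  obtain ⟨o, ho⟩ := hG
  -- The colour tells whether the corner is met first or second once the discs are reoriented by
  -- `o`. As no band is then twisted, it alternates along free sides too.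
  let c : (E × Bool) × Bool → Bool := fun x => xor x.2 (o (G.vert x.1))
  have hc : ∀ x, c (G.arcEnd x) = !c x := by
    rintro ⟨h, s⟩
    have h1 := G.vert_rot (G.rot.symm h)
    rw [Equiv.apply_symm_apply] at h1
    cases s <;> simp [c, arcEnd, G.vert_rot, ← h1]
  have hp : ∀ P : G.SpanningSubgraph, ∀ x, c (pairing P.state x) = !c x := by
    rintro P ⟨⟨e, b⟩, s⟩
    by_cases h : e ∈ P.edges
    · simp only [c, pairing, shift, state_of_mem h, ho e]
      cases b <;> simp only [Bool.xor_true, Bool.not_true, Bool.not_false] <;>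
        cases s <;> cases o (G.vert (e, false)) <;> cases o (G.vert (e, true)) <;> rfl
    · simp [c, pairing, shift, state_of_notMem h]
  obtain ⟨t₀, n, ht₀, ht, h1, h2, h3, h4⟩ := exists_pairing_of_toggle hQ
  by_cases hq : Q.state e = t₀
  · have := h1 hq
    have := h4 fun h => state_ne_state he (hq.trans h.symm)
    omega
  by_cases hq' : Q'.state e = t₀
  · have := h3 hq'
    have := h2 hq
    omega
  -- Otherwise `t₀` is the sum of the pairings of `Q` and `Q'`. The colour is reversed by all three,
  -- yet reversing it twice restores it.
  exfalso
  set a : (E × Bool) × Bool := ((e, false), false) with ha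
  have h5 := G.coloring_shift_of_joined (fun e' _ => Q.state_ne e') hc (fun x _ => hp Q x) ht₀
    (x := a) rfl ((ht a rfl t₀).2 (Or.inr rfl))
  have h6 : t₀ = (xor (Q.state e).1 (Q'.state e).1, xor (Q.state e).2 (Q'.state e).2) := by
    rcases eq_or_eq_or_eq_xor (Q.state_ne e) (Q'.state_ne e) (state_ne_state he) t₀ with
      h | h | h | h
    exacts [absurd h ht₀, absurd h.symm hq, absurd h.symm hq', h]
  have h7 : c (shift (Q'.state e) a) = !c a := hp Q' a
  have h8 : c (shift (Q.state e) (shift (Q'.state e) a)) = !c (shift (Q'.state e) a) :=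
    hp Q (shift (Q'.state e) a)
  rw [shift_shift, ← h6, h5, h7] at h8
  cases c a <;> simp at h8

/-- In an orientable ribbon graph, the parity of `f(A) + |A|` does not depend on `A`. -/
theorem even_f_add_card_iff [Finite V] [Finite E] (hG : G.Orientable) (A : Finset E) :
    Even ((⟨A⟩ : G.SpanningSubgraph).f + A.card) ↔ Even ((⟨∅⟩ : G.SpanningSubgraph).f) := by
  induction A using Finset.induction_on with
  | empty => simp
  | insert e A he ih =>
    rw [← ih, Finset.card_insert_of_notMem he]
    have := f_toggle_of_orientable hG (Q := ⟨insert e A⟩) (Q' := ⟨A⟩) (e := e)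
      (fun e' he' => by simp [he']) (by simp [he])
    rcases this with h | h
    · rw [h, show (⟨A⟩ : G.SpanningSubgraph).f + 1 + (A.card + 1) =
        (⟨A⟩ : G.SpanningSubgraph).f + A.card + 2 by ring]
      simp [Nat.even_add]
    · rw [h, show (⟨insert e A⟩ : G.SpanningSubgraph).f + 1 + A.card =
        (⟨insert e A⟩ : G.SpanningSubgraph).f + (A.card + 1) by ring]

/-- If every change of a single edge of `Q` increases the number of boundary components, then the
ribbon graph is orientable. -/
theorem orientable_of_forall_f_lt [Finite V] [Finite E] (Q : G.SpanningSubgraph)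
    (h : ∀ e, Q.f < (⟨symmDiff Q.edges {e}⟩ : G.SpanningSubgraph).f) : G.Orientable := by
  classical
  obtain ⟨c, hc⟩ := G.exists_coloring Q.state_ne
  -- Since toggling `e` raises `f`, the outside pairing `t₀` is that of the toggled subgraph, so `c`
  -- alternates along it as well. Any `P` uses at `e` one of these two pairings.
  have hflip : ∀ P : G.SpanningSubgraph, ∀ x, c (pairing P.state x) = !c x := by
    intro P x
    set e := x.1.1 with hxe
    by_cases hs : P.state e = Q.state e
    · rw [pairing, ← hxe, hs]; exact (hc x).2
    set Q' : G.SpanningSubgraph := ⟨symmDiff Q.edges {e}⟩ with hQ'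
    have hQ : ∀ e', e' ≠ e → (e' ∈ Q.edges ↔ e' ∈ Q'.edges) := by
      intro e' he'; simp [hQ', Finset.mem_symmDiff, he']
    have he : e ∈ Q.edges ↔ e ∉ Q'.edges := by simp [hQ', Finset.mem_symmDiff]
    obtain ⟨t₀, n, ht₀, ht, h1, h2, h3, h4⟩ := exists_pairing_of_toggle hQ
    have hlt : Q.f < Q'.f := h e
    have h5 : Q'.state e = t₀ := by
      by_contra h5
      have := h4 h5
      by_cases h6 : Q.state e = t₀
      · have := h1 h6; omega
      · have := (h2 h6).1; omega
    have h6 : P.state e = Q'.state e := by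
      have h7 : e ∈ P.edges ↔ e ∈ Q'.edges := by
        by_contra h7
        apply hs
        have : e ∈ P.edges ↔ e ∈ Q.edges := by tauto
        simp only [state, this]
      simp only [state, h7]
    rw [pairing, ← hxe, h6, h5]
    exact G.coloring_shift_of_joined (fun e' _ => Q.state_ne e') (fun x => (hc x).1)
      (fun x _ => (hc x).2) ht₀ hxe.symm ((ht x hxe.symm t₀).2 (Or.inr rfl))
  have hends : ∀ h, c (h, true) = !c (h, false) := by
    rintro ⟨e, b⟩
    simpa [pairing, shift, state] using hflip ⟨∅⟩ ((e, b), false)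
  have hstep : ∀ x y, (⟨∅⟩ : G.SpanningSubgraph).BoundaryStep x y → c y = !c x := by
    intro x y hxy
    cases hxy with
    | arc h => simpa [arcEnd] using (hc (h, true)).1
    | side e he b s => simp at he
    | segment e he b => exact hends _
  -- Without edges the components are the vertices. Correcting `c` by the end of the half-edge makes
  -- it constant around each vertex disc; the value at bare vertices is arbitrary.
  obtain ⟨y, hy⟩ := (⟨∅⟩ : G.SpanningSubgraph).exists_comp_component_eq
    (Sum.elim (Quot.lift (fun x => xor x.2 (c x)) (by
      intro x y hxy
      have h1 := hstep x y hxy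
      cases hxy with
      | arc h => rw [h1]; simp
      | side e he b s => simp at he
      | segment e he b => rw [h1]; simp)) (fun _ => false)) (by simp)
  let o : V → Bool := fun v => y (Quot.mk _ v)
  have ho : ∀ h, o (G.vert h) = c (h, false) := fun h =>
    (hy (Sum.inl (Quot.mk _ (h, false)))).trans (Bool.false_xor _)
  refine ⟨o, fun e => ?_⟩
  rw [ho, ho]
  have h1 := hflip ⟨{e}⟩ ((e, false), false)
  have h2 := hends (e, true)
  simp only [pairing, shift, state, Finset.mem_singleton, if_true, Bool.false_xor] at h1
  revert h1
  cases hte : G.twisted e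
  · simp only [Bool.not_false]
    rw [h2]
    cases c ((e, true), false) <;> cases c ((e, false), false) <;> simp
  · simp only [Bool.not_true]
    cases c ((e, true), false) <;> cases c ((e, false), false) <;> simp

/-- The exchange property of minimal numbers of boundary components. -/
theorem exists_exchange [Finite V] [Finite E] {X Y : Finset E} {n : ℕ}
    (hn : ∀ Q : G.SpanningSubgraph, n ≤ Q.f) (hX : (⟨X⟩ : G.SpanningSubgraph).f = n)
    (hY : (⟨Y⟩ : G.SpanningSubgraph).f = n) {u : E} (hu : u ∈ symmDiff X Y) :
    ∃ v ∈ symmDiff X Y, (⟨symmDiff X {u, v}⟩ : G.SpanningSubgraph).f = n := by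
  by_contra! hcon
  set Z : G.SpanningSubgraph := ⟨symmDiff X {u}⟩ with hZ
  have hZu : ∀ e, e ∈ Z.edges ↔ (e ∈ X ∧ e ≠ u) ∨ (e ∉ X ∧ e = u) := by
    intro e
    simp only [hZ, Finset.mem_symmDiff, Finset.mem_singleton]
    tauto
  have hZn : Z.f = n + 1 := by
    have h1 := hcon u hu
    rw [Finset.pair_eq_singleton] at h1
    have h2 := hn Z
    have h3 : Z.f ≤ (⟨X⟩ : G.SpanningSubgraph).f + 1 :=
      f_le_add_one (e := u) fun e he => by rw [hZu]; simp [he]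
    change Z.f ≠ n at h1
    omega
  -- Toggling an edge that meets two boundary components of `Z` would bring `f` back to `n`.
  have hv : ∀ v ∈ symmDiff X Y, v ≠ u → ∀ x y : (E × Bool) × Bool, x.1.1 = v → y.1.1 = v →
      Quot.mk Z.BoundaryStep x = Quot.mk Z.BoundaryStep y := by
    intro v hv hvu x y hx hy
    by_contra hxy
    apply hcon v hv
    have hmem : ∀ e, e ∈ symmDiff X {u, v} ↔ (e ∈ X ∧ e ≠ u ∧ e ≠ v) ∨
        (e ∉ X ∧ (e = u ∨ e = v)) := by
      intro e
      simp only [Finset.mem_symmDiff, Finset.mem_insert, Finset.mem_singleton]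
      tauto
    have := f_add_one_of_ne (Q := Z) (Q' := ⟨symmDiff X {u, v}⟩) (e := v)
      (fun e he => by rw [hZu, hmem]; simp [he]) (by rw [hZu, hmem]; simp [hvu]) hx hy hxy
    omega
  -- `Z` and `Y` agree at `u` and off `symmDiff X Y`. At the remaining edges all corners lie on one
  -- circle of `Z`, so each boundary step of `Y` stays within a circle of `Z`.
  have hle : Nat.card (Quot Z.BoundaryStep) ≤
      Nat.card (Quot (⟨Y⟩ : G.SpanningSubgraph).BoundaryStep) := by
    have key : ∀ e, (∀ x y : (E × Bool) × Bool, x.1.1 = e → y.1.1 = e →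
        Quot.mk Z.BoundaryStep x = Quot.mk Z.BoundaryStep y) ∨ (e ∈ Y ↔ e ∈ Z.edges) := by
      intro e
      by_cases he : e ∈ symmDiff X Y
      · by_cases heu : e = u
        · right
          rw [hZu]
          rw [Finset.mem_symmDiff] at he
          tauto
        · exact Or.inl (hv e he heu)
      · right
        have heu : e ≠ u := by rintro rfl; exact he hu
        rw [hZu]
        rw [Finset.mem_symmDiff] at he
        tauto
    refine card_quot_le_card_quot ?_
    intro x y hxy
    cases hxy with
    | arc h => exact Quot.sound (BoundaryStep.arc h)
    | side e he b s =>
      rcases key e with h | h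
      · exact h _ _ rfl rfl
      · exact Quot.sound (BoundaryStep.side e (h.1 he) b s)
    | segment e he b =>
      rcases key e with h | h
      · exact h _ _ rfl rfl
      · exact Quot.sound (BoundaryStep.segment e (mt h.2 he) b)
  have : Z.f ≤ (⟨Y⟩ : G.SpanningSubgraph).f := by
    rw [f, f, BoundaryComponent, BoundaryComponent, Nat.card_sum, Nat.card_sum]
    omega
  omega

end SpanningSubgraph

end RibbonGraph

/-! ## The Euler genus -/

namespace RibbonGraph

namespace SpanningSubgraph

variable {V E : Type*} {G : RibbonGraph V E}

/-- The incidence matrix over `ℤ/2ℤ`; loops have a zero column. -/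
def incidence [DecidableEq V] (Q : G.SpanningSubgraph) : Matrix V Q.edges (ZMod 2) :=
  fun v e => (if G.vert (e.1, false) = v then 1 else 0) + (if G.vert (e.1, true) = v then 1 else 0)

theorem boundaryOne_eq_mulVecLin [DecidableEq V] (Q : G.SpanningSubgraph) :
    Q.boundaryOne = Q.incidence.mulVecLin := by
  ext x v
  simp [boundaryOne, incidence, Matrix.mulVec, dotProduct, Pi.single_apply, add_mul, eq_comm]

theorem incidence_transpose_mulVec [Fintype V] [DecidableEq V] (Q : G.SpanningSubgraph)
    (y : V → ZMod 2) (e : Q.edges) :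
    (Q.incidence.transpose.mulVecLin y) e = y (G.vert (e.1, false)) + y (G.vert (e.1, true)) := by
  simp [incidence, Matrix.vecMul, dotProduct, mul_add, Finset.sum_add_distrib]

theorem ker_incidence_transpose [Fintype V] [DecidableEq V] (Q : G.SpanningSubgraph) :
    LinearMap.ker Q.incidence.transpose.mulVecLin =
      LinearMap.range (LinearMap.funLeft (ZMod 2) (ZMod 2) (Quot.mk Q.Joined)) := by
  ext y
  rw [LinearMap.mem_ker, LinearMap.mem_range]
  constructor
  · intro h
    refine ⟨Quot.lift y ?_, rfl⟩
    rintro _ _ ⟨e, he, rfl, rfl⟩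
    have := congrFun h ⟨e, he⟩
    rw [incidence_transpose_mulVec] at this
    exact CharTwo.add_eq_zero.1 this
  · rintro ⟨z, rfl⟩
    funext e
    rw [incidence_transpose_mulVec]
    refine CharTwo.add_eq_zero.2 (congrArg z (Quot.sound ⟨e.1, e.2, rfl, rfl⟩))

/-- The transposed matrix has the same rank, and its kernel consists of the functions constant on
connected components. -/
theorem finrank_range_boundaryOne_add_k [Fintype V] [DecidableEq V] (Q : G.SpanningSubgraph) :
    Module.finrank (ZMod 2) (LinearMap.range Q.boundaryOne) + Q.k = Fintype.card V := by
  have : Fintype (Quot Q.Joined) := Fintype.ofFinite _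
  have h1 := LinearMap.finrank_range_add_finrank_ker Q.incidence.transpose.mulVecLin
  rw [ker_incidence_transpose, LinearMap.finrank_range_of_inj
    (LinearMap.funLeft_injective_of_surjective _ _ _ Quot.mk_surjective), Module.finrank_pi,
    Module.finrank_pi, ← Nat.card_eq_fintype_card (α := Quot Q.Joined)] at h1
  rw [← h1, boundaryOne_eq_mulVecLin]
  exact congrArg (· + Q.k) (Matrix.rank_transpose Q.incidence).symm

theorem ker_boundaryTwo (Q : G.SpanningSubgraph) :
    LinearMap.ker Q.boundaryTwo =
      LinearMap.range (LinearMap.funLeft (ZMod 2) (ZMod 2)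
        (BoundaryComponent.component : Q.BoundaryComponent → Q.Component)) := by
  ext x
  rw [LinearMap.mem_ker, LinearMap.mem_range]
  constructor
  · intro h
    obtain ⟨y, hy⟩ := Q.exists_comp_component_eq x fun e he =>
      CharTwo.add_eq_zero.1 (congrFun h ⟨e, he⟩)
    exact ⟨y, funext hy⟩
  · rintro ⟨z, rfl⟩
    funext e
    exact CharTwo.add_eq_zero.2 rfl

theorem finrank_range_boundaryTwo_add_k [Finite V] [Finite E] (Q : G.SpanningSubgraph) :
    Module.finrank (ZMod 2) (LinearMap.range Q.boundaryTwo) + Q.k = Q.f := by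
  have : Fintype Q.Component := Fintype.ofFinite _
  have : Fintype Q.BoundaryComponent := Fintype.ofFinite _
  have h1 := LinearMap.finrank_range_add_finrank_ker Q.boundaryTwo
  rw [ker_boundaryTwo, LinearMap.finrank_range_of_inj
    (LinearMap.funLeft_injective_of_surjective _ _ _ Q.component_surjective), Module.finrank_pi,
    Module.finrank_pi, ← Nat.card_eq_fintype_card, ← Nat.card_eq_fintype_card] at h1
  exact h1

/-- Euler's formula. -/
theorem eulerGenus_add [Fintype V] [DecidableEq V] [Fintype E] (Q : G.SpanningSubgraph) :
    Q.eulerGenus + Fintype.card V + Q.f = Q.edges.card + 2 * Q.k := by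
  have h1 := LinearMap.finrank_range_add_finrank_ker Q.boundaryOne
  rw [Module.finrank_pi, Fintype.card_coe] at h1
  have h2 := Q.finrank_range_boundaryOne_add_k
  have h3 := Q.finrank_range_boundaryTwo_add_k
  have h4 := Submodule.finrank_quotient_add_finrank
    ((LinearMap.range Q.boundaryTwo).comap (LinearMap.ker Q.boundaryOne).subtype)
  have hle : LinearMap.range Q.boundaryTwo ≤ LinearMap.ker Q.boundaryOne := by
    rintro _ ⟨x, rfl⟩
    exact Q.boundaryOne_boundaryTwo x
  rw [(Submodule.comapSubtypeEquivOfLe hle).finrank_eq] at h4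
  rw [eulerGenus]
  omega

/-- Euler's formula together with k ≤ f and γ ≥ 0. -/
theorem card_le_card_add_k [Fintype V] [DecidableEq V] [Fintype E] (Q : G.SpanningSubgraph) :
    Fintype.card V ≤ Q.edges.card + Q.k := by
  have h1 := Q.eulerGenus_add
  have h2 := Q.k_le_f
  omega

end SpanningSubgraph

end RibbonGraph

/-! ## Forests, quasi-trees and the main result -/

namespace RibbonGraph

namespace SpanningSubgraph

theorem exists_isMaximalForest {V E : Type*} [Finite E] [DecidableEq E] (G : RibbonGraph V E) :
    ∃ T : G.SpanningSubgraph, T.IsMaximalForest := by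
  obtain ⟨T, hT⟩ :=
    (Set.toFinite {A : Finset E | (⟨A⟩ : G.SpanningSubgraph).IsForest}).exists_maximal
      ⟨∅, fun e he => by simp at he⟩
  exact ⟨⟨T⟩, hT.1, fun Q' hQ' h => SpanningSubgraph.ext (hT.eq_of_ge hQ' h)⟩

variable {V E : Type*} [Fintype V] [DecidableEq E] {G : RibbonGraph V E}

theorem IsForest.of_insert {e : E} {A : Finset E} (he : e ∉ A)
    (h : (⟨insert e A⟩ : G.SpanningSubgraph).IsForest) : (⟨A⟩ : G.SpanningSubgraph).IsForest := by
  intro e' he'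
  have hne : e' ≠ e := by rintro rfl; exact he he'
  have h1 := h e' (Finset.mem_insert_of_mem he')
  simp only at h1 he'
  have h2 : Quot.mk (⟨(insert e A).erase e'⟩ : G.SpanningSubgraph).Joined (G.vert (e', false)) ≠
      Quot.mk (⟨(insert e A).erase e'⟩ : G.SpanningSubgraph).Joined (G.vert (e', true)) := by
    intro h2
    have h3 := k_insert_of_joined _ h2
    rw [Finset.insert_erase (Finset.mem_insert_of_mem he')] at h3
    omega
  have h3 : Quot.mk (⟨A.erase e'⟩ : G.SpanningSubgraph).Joined (G.vert (e', false)) ≠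
      Quot.mk (⟨A.erase e'⟩ : G.SpanningSubgraph).Joined (G.vert (e', true)) := fun h3 =>
    h2 (joined_mono (Finset.erase_subset_erase e' (Finset.subset_insert e A)) h3)
  have h4 := k_insert_add_one _ h3
  rw [Finset.insert_erase he'] at h4
  simp only
  omega

theorem IsForest.card_add_k {A : Finset E} (h : (⟨A⟩ : G.SpanningSubgraph).IsForest) :
    A.card + (⟨A⟩ : G.SpanningSubgraph).k = Fintype.card V := by
  induction A using Finset.induction_on with
  | empty => rw [Finset.card_empty, zero_add, k_empty]
  | insert e A he ih =>
    have h1 := ih (h.of_insert he)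
    have h2 := h e (Finset.mem_insert_self e A)
    simp only [Finset.erase_insert he] at h2
    have h3 := k_insert_add_one (G := G) A (e := e) fun h3 => by
      rw [k_insert_of_joined A h3] at h2
      exact lt_irrefl _ h2
    rw [Finset.card_insert_of_notMem he]
    omega

variable [Fintype E]

/-- Deleting an edge without raising `k` would violate `card_le_card_add_k`. -/
theorem isForest_of_card_add_k {Q : G.SpanningSubgraph}
    (h : Q.edges.card + Q.k = Fintype.card V) : Q.IsForest := by
  classical
  intro e he
  have h1 := card_le_card_add_k (⟨Q.edges.erase e⟩ : G.SpanningSubgraph)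
  have h2 := Finset.card_erase_add_one he
  simp only at h1
  omega

/-- An edge of `G` between two components of `T` could be added, keeping |A| + k = v and hence a
forest. -/
theorem IsMaximalForest.k_eq {T : G.SpanningSubgraph} (hT : T.IsMaximalForest) : T.k = G.k := by
  refine le_antisymm (card_quot_le_card_quot ?_) (k_le_k (Finset.subset_univ _))
  rintro _ _ ⟨e, -, rfl, rfl⟩
  by_contra hne
  have he : e ∉ T.edges := fun he => hne (Quot.sound ⟨e, he, rfl, rfl⟩)
  have h1 := k_insert_add_one T.edges hne
  have h2 : T.edges.card + T.k = Fintype.card V := hT.1.card_add_k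
  have h3 : (⟨insert e T.edges⟩ : G.SpanningSubgraph).IsForest := by
    refine isForest_of_card_add_k ?_
    rw [Finset.card_insert_of_notMem he]
    change _ = T.k at h1
    omega
  have h4 := congrArg edges (hT.2 _ h3 (Finset.subset_insert e T.edges))
  exact he (h4 ▸ Finset.mem_insert_self e T.edges)

theorem IsMaximalForest.card_add_k {T : G.SpanningSubgraph} (hT : T.IsMaximalForest) :
    T.edges.card + G.k = Fintype.card V := by
  rw [← hT.k_eq]
  exact hT.1.card_add_k

/-- For a forest with k(G) components Euler's formula reads γ + f = k, while k ≤ f. -/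
theorem IsMaximalForest.f_eq {T : G.SpanningSubgraph} (hT : T.IsMaximalForest) : T.f = G.k := by
  classical
  have h1 := T.eulerGenus_add
  have h2 := hT.card_add_k
  have h3 := T.k_le_f
  have h4 := hT.k_eq
  omega

/-- A spanning ribbon subgraph with as many connected components as `G` contains a spanning
quasi-tree that arises by deleting edges that meet two boundary components. -/
theorem exists_subset_f_eq (A : Finset E) (hA : (⟨A⟩ : G.SpanningSubgraph).k = G.k) :
    ∃ F ⊆ A, (⟨F⟩ : G.SpanningSubgraph).f = G.k ∧
      F.card + (⟨A⟩ : G.SpanningSubgraph).f = A.card + G.k := by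
  induction A using Finset.strongInduction with
  | H A ih =>
    by_cases hf : (⟨A⟩ : G.SpanningSubgraph).f = G.k
    · exact ⟨A, subset_rfl, hf, by rw [hf]⟩
    obtain ⟨e, he, hne⟩ : ∃ e ∈ A,
        Quot.mk (⟨A⟩ : G.SpanningSubgraph).BoundaryStep ((e, false), false) ≠
          Quot.mk (⟨A⟩ : G.SpanningSubgraph).BoundaryStep ((e, false), true) := by
      by_contra! h
      exact hf ((f_eq_k_of_sides _ h).trans hA)
    have hiff : ∀ e', e' ≠ e → (e' ∈ A ↔ e' ∈ A.erase e) := fun e' he' => by simp [he']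
    have h1 : (⟨A.erase e⟩ : G.SpanningSubgraph).f + 1 = (⟨A⟩ : G.SpanningSubgraph).f :=
      f_add_one_of_ne (e := e) hiff (by simp [he]) rfl rfl hne
    have h2 : (⟨A.erase e⟩ : G.SpanningSubgraph).k = G.k := by
      by_cases hj : Quot.mk (⟨A.erase e⟩ : G.SpanningSubgraph).Joined (G.vert (e, false)) =
          Quot.mk (⟨A.erase e⟩ : G.SpanningSubgraph).Joined (G.vert (e, true))
      · rw [← hA, ← k_insert_of_joined _ hj, Finset.insert_erase he]
      -- If `e` were a bridge, its two ends would lie on different boundary components after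
      -- deletion, so restoring it would lower `f`, contrary to `h1`.
      · have h3 : (⟨A⟩ : G.SpanningSubgraph).f + 1 = (⟨A.erase e⟩ : G.SpanningSubgraph).f :=
          f_add_one_of_ne (e := e) (x := ((e, false), false)) (y := ((e, true), false))
            (fun e' he' => (hiff e' he').symm) (by simp [he]) rfl rfl
            fun h => hj (joined_of_boundary_eq h)
        omega
    obtain ⟨F, hFA, hF, hcard⟩ := ih _ (Finset.erase_ssubset he) h2
    have h3 := Finset.card_erase_add_one he
    exact ⟨F, hFA.trans (Finset.erase_subset e A), hF, by omega⟩

theorem f_union_le (A B : Finset E) :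
    (⟨A ∪ B⟩ : G.SpanningSubgraph).f ≤ (⟨A⟩ : G.SpanningSubgraph).f + B.card := by
  induction B using Finset.induction_on with
  | empty => simp
  | insert e B he ih =>
    have h := f_le_add_one (Q := (⟨A ∪ insert e B⟩ : G.SpanningSubgraph)) (Q' := ⟨A ∪ B⟩) (e := e)
      fun e' he' => by simp [he']
    rw [Finset.card_insert_of_notMem he]
    omega

end SpanningSubgraph

theorem mem_feasible_iff {V E : Type*} [Finite V] [Fintype E] (G : RibbonGraph V E)
    {F : Finset E} :
    F ∈ G.deltaMatroid.feasible ↔ (⟨F⟩ : G.SpanningSubgraph).f = G.k := by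
  rw [← SpanningSubgraph.isQuasiTree_iff]
  constructor
  · rintro ⟨Q, hQ, rfl⟩
    exact hQ
  · intro h
    exact ⟨_, h, rfl⟩

variable {V E : Type*} [Fintype V] [DecidableEq V] [Fintype E]

/-- The Euler genus of a spanning quasi-tree. -/
theorem eulerGenus_add_of_isQuasiTree (G : RibbonGraph V E) {Q : G.SpanningSubgraph}
    (hQ : Q.IsQuasiTree) : Q.eulerGenus + Fintype.card V = Q.edges.card + G.k := by
  have h1 := Q.eulerGenus_add
  have h2 := Q.isQuasiTree_iff.1 hQ
  have h3 : Q.k = G.k := hQ.1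
  omega

/-- A spanning quasi-tree has at most `γ(G) + v(G) - k(G)` edges. -/
theorem card_add_k_le_of_feasible (G : RibbonGraph V E) {F : Finset E}
    (hF : F ∈ G.deltaMatroid.feasible) : F.card + G.k ≤ G.eulerGenus + Fintype.card V := by
  classical
  rw [mem_feasible_iff] at hF
  have h1 := G.whole.eulerGenus_add
  -- `G` arises from `F` by adding the remaining edges, each of which raises `f` by at most one.
  have h2 := SpanningSubgraph.f_union_le (G := G) F Fᶜ
  rw [Finset.union_compl, hF, Finset.card_compl] at h2
  have h3 := F.card_le_univ
  have h4 : G.whole.edges.card = Fintype.card E := Finset.card_univ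
  change G.whole.f ≤ _ at h2
  change _ ≤ G.whole.eulerGenus + _
  change _ = _ + 2 * G.k at h1
  omega

/-- Starting from all of `G`, exactly f(G) − k(G) deletions reach a quasi-tree, which attains the
upper bound on cardinalities. -/
theorem exists_feasible_card_add_k_eq (G : RibbonGraph V E) :
    ∃ F ∈ G.deltaMatroid.feasible, F.card + G.k = G.eulerGenus + Fintype.card V := by
  classical
  obtain ⟨F, -, hF, hcard⟩ := SpanningSubgraph.exists_subset_f_eq (G := G) Finset.univ rfl
  refine ⟨F, G.mem_feasible_iff.2 hF, ?_⟩
  have h1 := G.whole.eulerGenus_add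
  change _ + G.whole.f = G.whole.edges.card + _ at hcard
  change _ = _ + 2 * G.k at h1
  change _ = G.whole.eulerGenus + _
  omega

end RibbonGraph

theorem SetSystem.rank_eq_of_forall_card_eq {E : Type*} {M : SetSystem E} {n : ℕ} {F : Finset E}
    (hF : F ∈ M.feasible) (h : ∀ F' ∈ M.feasible, F'.card = n) : M.rank = n := by
  have : Finset.card '' M.feasible = {n} := by
    ext m
    constructor
    · rintro ⟨F', hF', rfl⟩
      exact h F' hF'
    · rintro rfl
      exact ⟨F, hF, h F hF⟩
  rw [rank, this, csSup_singleton]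

theorem propositionp {V E : Type*} [Fintype V] [DecidableEq V] [Fintype E] [DecidableEq E]
    (G : RibbonGraph V E) :
    G.deltaMatroid.IsDeltaMatroid ∧
    (∀ m : ℕ, Set.BijOn (fun Q : G.SpanningSubgraph => Q.edges)
      {Q | Q.IsQuasiTree ∧ (Q.eulerGenus : ℤ) = (m : ℤ) - (G.v : ℤ) + (G.k : ℤ)}
      {F | F ∈ G.deltaMatroid.feasible ∧ F.card = m}) ∧
    (∀ T : G.SpanningSubgraph, T.IsMaximalForest →
      G.deltaMatroid.lower.rank = T.edges.card) ∧
    (G.deltaMatroid.lower.rank : ℤ) = (G.v : ℤ) - (G.k : ℤ) ∧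
    (G.eulerGenus : ℤ) = G.deltaMatroid.width ∧
    (G.deltaMatroid.IsEven ↔ G.Orientable) := by
  obtain ⟨T₀, hT₀⟩ := RibbonGraph.SpanningSubgraph.exists_isMaximalForest G
  have hv : G.v = Fintype.card V := rfl
  have hmin : ∀ F ∈ G.deltaMatroid.feasible, G.v ≤ F.card + G.k := by
    rintro F ⟨Q, hQ, rfl⟩
    have := G.eulerGenus_add_of_isQuasiTree hQ
    omega
  have hlower : ∀ T : G.SpanningSubgraph, T.IsMaximalForest →
      G.deltaMatroid.lower.rank = T.edges.card := by
    intro T hT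
    have hTf : T.edges ∈ G.deltaMatroid.feasible := G.mem_feasible_iff.2 hT.f_eq
    have hTc := hT.card_add_k
    have hTmin : ∀ F ∈ G.deltaMatroid.feasible, T.edges.card ≤ F.card := by
      intro F hF
      have := hmin F hF
      omega
    exact SetSystem.rank_eq_of_forall_card_eq (F := T.edges) ⟨hTf, hTmin⟩
      fun F' hF' => le_antisymm (hF'.2 _ hTf) (hTmin F' hF'.1)
  have hlow : (G.deltaMatroid.lower.rank : ℤ) = (G.v : ℤ) - (G.k : ℤ) := by
    have h1 := hlower T₀ hT₀
    have h2 := hT₀.card_add_k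
    omega
  refine ⟨⟨⟨T₀.edges, G.mem_feasible_iff.2 hT₀.f_eq⟩, ?_⟩, ?_, hlower, hlow, ?_, ?_⟩
  · intro X hX Y hY u hu
    obtain ⟨v, hv, h⟩ := RibbonGraph.SpanningSubgraph.exists_exchange (G := G) (n := G.k)
      (fun Q => (RibbonGraph.SpanningSubgraph.k_le_k (Finset.subset_univ _)).trans Q.k_le_f)
      (G.mem_feasible_iff.1 hX) (G.mem_feasible_iff.1 hY) hu
    exact ⟨v, hv, G.mem_feasible_iff.2 h⟩
  · intro m
    refine ⟨?_, fun Q _ Q' _ h => RibbonGraph.SpanningSubgraph.ext h, ?_⟩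
    · rintro Q ⟨hQ, hm⟩
      have := G.eulerGenus_add_of_isQuasiTree hQ
      exact ⟨⟨Q, hQ, rfl⟩, by beta_reduce; omega⟩
    · rintro _ ⟨⟨Q, hQ, rfl⟩, hm⟩
      have := G.eulerGenus_add_of_isQuasiTree hQ
      exact ⟨Q, ⟨hQ, by omega⟩, rfl⟩
  · obtain ⟨F, hF, hcard⟩ := G.exists_feasible_card_add_k_eq
    have hFmax : ∀ F' ∈ G.deltaMatroid.feasible, F'.card ≤ F.card := by
      intro F' hF'
      have := G.card_add_k_le_of_feasible hF'
      omega
    have hupper : G.deltaMatroid.upper.rank = F.card :=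
      SetSystem.rank_eq_of_forall_card_eq (F := F) ⟨hF, hFmax⟩
        fun F' hF' => le_antisymm (hFmax F' hF'.1) (hF'.2 _ hF)
    rw [SetSystem.width, hlow, hupper]
    omega
  · constructor
    · intro heven
      refine RibbonGraph.SpanningSubgraph.orientable_of_forall_f_lt T₀ fun e => ?_
      have h1 : G.k ≤ (⟨symmDiff T₀.edges {e}⟩ : G.SpanningSubgraph).f :=
        (RibbonGraph.SpanningSubgraph.k_le_k (Finset.subset_univ _)).trans
          (RibbonGraph.SpanningSubgraph.k_le_f _)
      rw [hT₀.f_eq]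
      -- Equality would make the toggled set feasible, although its cardinality has the other
      -- parity.
      refine lt_of_le_of_ne h1 fun h2 => ?_
      have h3 := heven _ (G.mem_feasible_iff.2 hT₀.f_eq) _ (G.mem_feasible_iff.2 h2.symm)
      by_cases he : e ∈ T₀.edges
      · have h4 : symmDiff T₀.edges {e} = T₀.edges.erase e := by
          ext x; simp only [Finset.mem_symmDiff, Finset.mem_singleton, Finset.mem_erase]
          by_cases hx : x = e <;> simp [hx, he]
        rw [h4, ← Finset.card_erase_add_one he, Nat.even_add_one] at h3
        tauto
      · have h4 : symmDiff T₀.edges {e} = insert e T₀.edges := by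
          ext x; simp only [Finset.mem_symmDiff, Finset.mem_singleton, Finset.mem_insert]
          by_cases hx : x = e <;> simp [hx, he]
        rw [h4, Finset.card_insert_of_notMem he, Nat.even_add_one] at h3
        tauto
    · intro hG F hF F' hF'
      have h1 := RibbonGraph.SpanningSubgraph.even_f_add_card_iff hG F
      rw [← RibbonGraph.SpanningSubgraph.even_f_add_card_iff hG F', G.mem_feasible_iff.1 hF,
        G.mem_feasible_iff.1 hF',
        Nat.even_add, Nat.even_add] at h1
      tauto
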